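/- Let $X$ be a connected finite CW complex with base point $x_0$, let $G$ be a finite group, and let $\phi\colon \pi_1(X)\to\mathbb{Z}$ and $f\colon \pi_1(X)\to G$ be group homomorphisms. Let $\rho\colon G\to \mathrm{Aut}_{\mathbb{Z}}(\mathbb{Z}[G])\cong \mathrm{GL}(|G|,\mathbb{Z})$ be the regular representation, given by right multiplication. Regard $\mathbb{Z}[t^{\pm1}]^{|G|}$ (row vectors) as a right $\mathbb{Z}[\pi_1(X)]$-module by $v\cdot g=t^{\phi(g)}\,v\,\rho(f(g))$, and let $H_1(X;\mathbb{Z}[t^{\pm1}]^{|G|})$ be the first homology of the chain complex $\mathbb{Z}[t^{\pm1}]^{|G|}\otimes_{\mathbb{Z}[\pi_1(X)]}C_*(\tilde X)$, where $\tilde X$ is the universal covering of $X$, on which $\pi_1(X)$ acts by deck transformations. The twisted Alexander polynomial $\Delta^{\rho\circ f}_{X,\phi}(t)\in\mathbb{Z}[t^{\pm1}]$ is the order of this finitely generated $\mathbb{Z}[t^{\pm1}]$-module, i.e. the greatest common divisor of the $n\times n$ minors of a presentation matrix with respect to $n$ generators; it exists and is well defined up to multiplication by a unit. Then $\Delta^{\rho\circ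 f}_{X,\phi}(t)=0$ if and only if the homomorphism $f\times\phi\colon\pi_1(X)\to G\times\mathbb{Z}$ has a nontrivial lift to $\mathbb{Z}[G\times\mathbb{Z}]\rtimes(G\times\mathbb{Z})$, where $G\times\mathbb{Z}$ acts on $\mathbb{Z}[G\times\mathbb{Z}]$ by left multiplication; that is, if and only if there is a group homomorphism $\tilde f\colon\pi_1(X)\to\mathbb{Z}[G\times\mathbb{Z}]\rtimes(G\times\mathbb{Z})$ such that $p\circ\tilde f=f\times\phi$ for the projection $p\colon\mathbb{Z}[G\times\mathbb{Z}]\rtimes(G\times\mathbb{Z})\to G\times\mathbb{Z}$, and $$\mathrm{Im}\,\tilde f\cap\bigl(\mathbb{Z}[G\times\mathbb{Z}]\times\{(e,0)\}\bigr)\neq\{(0;e,0)\}.$$ -/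

import Mathlib

open scoped LaurentPolynomial TensorProduct

universe u v w

noncomputable section

namespace TwistedAlexander

/-! ### The fundamental group and the universal covering -/

/-- The fundamental group of `X` at `x₀`, where the product `γ * γ'` is the class of the loop that
first runs through `γ` and then through `γ'`. The multiplication of Mathlib's `FundamentalGroup`
is the opposite one (there `p * q = q.trans p`). -/
abbrev Pi1 (X : Type u) [TopologicalSpace X] (x₀ : X) : Type u :=
  (FundamentalGroup X x₀)ᵐᵒᵖ

/-- The homotopy class of loops underlying an element of the fundamental group. -/
def Pi1.loop {X : Type u} [TopologicalSpace X] {x₀ : X} (g : Pi1 X x₀) :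
    Path.Homotopic.Quotient x₀ x₀ :=
  g.unop.toPath

/-- The universal covering of `X` (for `X` a connected CW complex, or any space which has one):
its points are the homotopy classes (relative to the end points) of paths that start at `x₀`. The
covering projection sends a path to its end point. -/
def UniversalCover {X : Type u} [TopologicalSpace X] (x₀ : X) : Type u :=
  Σ x : X, Path.Homotopic.Quotient x₀ x

section Cover

variable {X : Type u} [TopologicalSpace X] {x₀ : X}

/-- The points of the universal covering that are reached from `p` by a path inside `U`. -/
def coverNhd (p : UniversalCover x₀) (U : Set X) : Set (UniversalCover x₀) :=
  {q | ∃ δ : Path p.1 q.1, Set.range δ ⊆ U ∧ q.2 = p.2.trans (Path.Homotopic.Quotient.mk δ)}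

/-- The usual topology of the universal covering, generated by the sets
`{[γ * δ] | δ a path in U starting at γ(1)}` for `U` open with `γ(1) ∈ U`. -/
instance : TopologicalSpace (UniversalCover x₀) :=
  TopologicalSpace.generateFrom
    {S | ∃ (p : UniversalCover x₀) (U : Set X), IsOpen U ∧ p.1 ∈ U ∧ S = coverNhd p U}

theorem trans_assoc' {a b c d : X} (p : Path.Homotopic.Quotient a b)
    (q : Path.Homotopic.Quotient b c) (r : Path.Homotopic.Quotient c d) :
    (p.trans q).trans r = p.trans (q.trans r) :=
  CategoryTheory.Category.assoc (W := FundamentalGroupoid.mk a)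
    (X := FundamentalGroupoid.mk b) (Y := FundamentalGroupoid.mk c)
    (Z := FundamentalGroupoid.mk d) p q r

theorem refl_trans' {a b : X} (p : Path.Homotopic.Quotient a b) :
    (Path.Homotopic.Quotient.refl a).trans p = p :=
  CategoryTheory.Category.id_comp (X := FundamentalGroupoid.mk a)
    (Y := FundamentalGroupoid.mk b) p

/-- The action of the fundamental group on the universal covering by deck transformations,
`[α] • [γ] = [α * γ]`. -/
instance : MulAction (Pi1 X x₀) (UniversalCover x₀) where
  smul g p := ⟨p.1, g.loop.trans p.2⟩
  one_smul p := Sigma.ext rfl (heq_of_eq (refl_trans' p.2))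
  mul_smul g h p := Sigma.ext rfl (heq_of_eq (trans_assoc' g.loop h.loop p.2))

theorem smul_fst (g : Pi1 X x₀) (p : UniversalCover x₀) : (g • p).1 = p.1 := rfl

theorem smul_snd (g : Pi1 X x₀) (p : UniversalCover x₀) : (g • p).2 = g.loop.trans p.2 := rfl

theorem smul_mem_coverNhd (g : Pi1 X x₀) {p q : UniversalCover x₀} {U : Set X}
    (h : q ∈ coverNhd p U) : g • q ∈ coverNhd (g • p) U := by
  obtain ⟨δ, hδ, hq⟩ := h
  refine ⟨δ, hδ, ?_⟩
  rw [smul_snd, hq]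
  exact (trans_assoc' _ _ _).symm

instance : ContinuousConstSMul (Pi1 X x₀) (UniversalCover x₀) where
  continuous_const_smul g := by
    refine continuous_generateFrom_iff.2 ?_
    rintro S ⟨p, U, hU, hp, rfl⟩
    have : (fun q : UniversalCover x₀ => g • q) ⁻¹' coverNhd p U = coverNhd (g⁻¹ • p) U := by
      ext q
      constructor
      · intro h
        simpa using smul_mem_coverNhd g⁻¹ h
      · intro h
        simpa using smul_mem_coverNhd g h
    rw [this]
    exact TopologicalSpace.isOpen_generateFrom_of_mem ⟨g⁻¹ • p, U, hU, hp, rfl⟩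

end Cover

/-! ### Singular chains -/

section Singular

/-- The singular `n`-simplices of `Y`. -/
abbrev SingularSimplex (Y : Type u) [TopologicalSpace Y] (n : ℕ) : Type u :=
  C(stdSimplex ℝ (Fin (n + 1)), Y)

/-- The singular `n`-chains of `Y` with integer coefficients. -/
abbrev SingularChain (Y : Type u) [TopologicalSpace Y] (n : ℕ) : Type u :=
  SingularSimplex Y n →₀ ℤ

/-- The `i`-th face inclusion of the standard `n`-simplex in the standard `(n + 1)`-simplex. -/
def faceInclusion (n : ℕ) (i : Fin (n + 2)) :
    C(stdSimplex ℝ (Fin (n + 1)), stdSimplex ℝ (Fin (n + 2))) :=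
  ⟨stdSimplex.map i.succAbove, stdSimplex.continuous_map i.succAbove⟩

/-- The singular boundary operator. -/
def singularBoundary (Y : Type u) [TopologicalSpace Y] (n : ℕ) :
    SingularChain Y (n + 1) →ₗ[ℤ] SingularChain Y n :=
  ∑ i : Fin (n + 2), (-1 : ℤ) ^ (i : ℕ) •
    Finsupp.lmapDomain ℤ ℤ fun σ : SingularSimplex Y (n + 1) => σ.comp (faceInclusion n i)

/-- The action of a group element on singular chains, for a group acting on the space. -/
def chainAction {Γ : Type v} [Group Γ] (Y : Type u) [TopologicalSpace Y] [MulAction Γ Y]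
    [ContinuousConstSMul Γ Y] (n : ℕ) (g : Γ) : SingularChain Y n →ₗ[ℤ] SingularChain Y n :=
  Finsupp.lmapDomain ℤ ℤ fun σ : SingularSimplex Y n =>
    (⟨fun y => g • y, continuous_const_smul g⟩ : C(Y, Y)).comp σ

theorem singularBoundary_chainAction {Γ : Type v} [Group Γ] (Y : Type u) [TopologicalSpace Y]
    [MulAction Γ Y] [ContinuousConstSMul Γ Y] (n : ℕ) (g : Γ) (c : SingularChain Y (n + 1)) :
    singularBoundary Y n (chainAction Y (n + 1) g c) =
      chainAction Y n g (singularBoundary Y n c) := by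
  simp only [singularBoundary, chainAction, LinearMap.sum_apply, LinearMap.smul_apply, map_sum,
    map_smul, Finsupp.lmapDomain_apply, ← Finsupp.mapDomain_comp]
  rfl

end Singular

/-! ### Twisted homology -/

section TwistedHomology

variable {X : Type u} [TopologicalSpace X] {x₀ : X} {R : Type v} [CommRing R]
  {ι : Type w} [Fintype ι] [DecidableEq ι]

/-- The right action of the fundamental group on `R[t, t⁻¹]ⁿ` (row vectors) given by
`v · g = t ^ φ(g) (v ρ(g))`. -/
def coeffAction (φ : Pi1 X x₀ →* Multiplicative ℤ) (ρ : Pi1 X x₀ →* GL ι R) (g : Pi1 X x₀)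
    (v : ι → R[T;T⁻¹]) : ι → R[T;T⁻¹] :=
  (LaurentPolynomial.T (φ g).toAdd : R[T;T⁻¹]) •
    Matrix.vecMul v ((ρ g : Matrix ι ι R).map LaurentPolynomial.C)

/-- The relations `v · g ⊗ c = v ⊗ g • c`, which turn the tensor product over `ℤ` into the tensor
product over the group ring `ℤ[π₁(X)]`. -/
def tensorRelations (φ : Pi1 X x₀ →* Multiplicative ℤ) (ρ : Pi1 X x₀ →* GL ι R) (n : ℕ) :
    Submodule R[T;T⁻¹] ((ι → R[T;T⁻¹]) ⊗[ℤ] SingularChain (UniversalCover x₀) n) :=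
  Submodule.span R[T;T⁻¹]
    {z | ∃ (g : Pi1 X x₀) (v : ι → R[T;T⁻¹]) (c : SingularChain (UniversalCover x₀) n),
      z = coeffAction φ ρ g v ⊗ₜ[ℤ] c - v ⊗ₜ[ℤ] chainAction (UniversalCover x₀) n g c}

/-- The twisted chains `R[t, t⁻¹]ⁿ ⊗_{ℤ[π₁(X)]} Cₙ(X̃)`. -/
abbrev TwistedChain (φ : Pi1 X x₀ →* Multiplicative ℤ) (ρ : Pi1 X x₀ →* GL ι R) (n : ℕ) :
    Type (max u v w) :=
  ((ι → R[T;T⁻¹]) ⊗[ℤ] SingularChain (UniversalCover x₀) n) ⧸ tensorRelations φ ρ n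

/-- The boundary operator `id ⊗ ∂` of the twisted chains. -/
def twistedBoundary (φ : Pi1 X x₀ →* Multiplicative ℤ) (ρ : Pi1 X x₀ →* GL ι R) (n : ℕ) :
    TwistedChain φ ρ (n + 1) →ₗ[R[T;T⁻¹]] TwistedChain φ ρ n :=
  Submodule.mapQ (tensorRelations φ ρ (n + 1)) (tensorRelations φ ρ n)
    (TensorProduct.AlgebraTensorModule.lTensor R[T;T⁻¹] (ι → R[T;T⁻¹])
      (singularBoundary (UniversalCover x₀) n)) <| by
    refine Submodule.span_le.2 ?_
    rintro _ ⟨g, v, c, rfl⟩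
    refine Submodule.subset_span ⟨g, v, singularBoundary (UniversalCover x₀) n c, ?_⟩
    simp [singularBoundary_chainAction]

/-- The first twisted homology `H₁(X; R[t, t⁻¹]ⁿ)`: the cycles modulo the boundaries. -/
abbrev TwistedH1 (φ : Pi1 X x₀ →* Multiplicative ℤ) (ρ : Pi1 X x₀ →* GL ι R) :
    Type (max u v w) :=
  LinearMap.ker (twistedBoundary φ ρ 0) ⧸
    (LinearMap.range (twistedBoundary φ ρ 1)).submoduleOf (LinearMap.ker (twistedBoundary φ ρ 0))

end TwistedHomology

/-! ### The order of a module and the twisted Alexander polynomial -/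

/-- `Δ` is an order of the `S`-module `M`: for some finite generating family `x₁, …, xₙ` of `M`,
`Δ` is a greatest common divisor of the determinants of all `n × n` matrices whose rows are
relations between the `xⱼ`, i.e. of the `n × n` minors of a presentation matrix of `M`. Over a
Noetherian unique factorization domain every finitely generated module has an order; it is unique
up to a unit. -/
def IsOrder (S : Type v) [CommRing S] (M : Type u) [AddCommGroup M] [Module S M] (Δ : S) : Prop :=
  ∃ (n : ℕ) (x : Fin n → M), Submodule.span S (Set.range x) = ⊤ ∧
    ∀ d : S, d ∣ Δ ↔
      ∀ A : Matrix (Fin n) (Fin n) S, (∀ i, ∑ j, A i j • x j = 0) → d ∣ A.det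

/-- `Δ ∈ R[t, t⁻¹]` is (a representative of) the twisted Alexander polynomial of `(X, φ, ρ)`, which
is defined up to multiplication by a unit. -/
def IsTwistedAlexanderPolynomial {X : Type u} [TopologicalSpace X] {x₀ : X} {R : Type v}
    [CommRing R] {ι : Type w} [Fintype ι] [DecidableEq ι] (φ : Pi1 X x₀ →* Multiplicative ℤ)
    (ρ : Pi1 X x₀ →* GL ι R) (Δ : R[T;T⁻¹]) : Prop :=
  IsOrder R[T;T⁻¹] (TwistedH1 φ ρ) Δ

/-! ### The regular representation and the semidirect product -/

/-- The regular representation `G → Aut_ℤ(ℤ[G])` by right multiplication, in the basis `G`: the row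
vector `e_h` is sent to `e_h ρ(g) = e_{hg}`. -/
def regularRep (G : Type v) [Group G] [Fintype G] [DecidableEq G] : G →* GL G ℤ :=
  MonoidHom.toHomUnits
    { toFun := fun g => Matrix.of fun h k => if h * g = k then 1 else 0
      map_one' := by
        ext h k
        simp [Matrix.one_apply]
      map_mul' := fun a b => by
        ext h k
        simp only [Matrix.mul_apply, Matrix.of_apply, ite_mul, one_mul, zero_mul,
          Finset.sum_ite_eq, Finset.mem_univ, if_true, mul_assoc] }

/-- The action of a group `Γ` on the additive group `ℤ[Γ]` by left multiplication. -/
def leftMul (Γ : Type v) [Group Γ] : Γ →* MulAut (Multiplicative (MonoidAlgebra ℤ Γ)) :=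
  (MulAutMultiplicative (G := MonoidAlgebra ℤ Γ)).symm.toMonoidHom.comp
    (AddAut.mulLeft.comp (MonoidAlgebra.of ℤ Γ).toHomUnits)

theorem leftMul_apply (Γ : Type v) [Group Γ] (g : Γ) (a : MonoidAlgebra ℤ Γ) :
    leftMul Γ g (Multiplicative.ofAdd a) =
      Multiplicative.ofAdd (MonoidAlgebra.single g (1 : ℤ) * a) := rfl

/-- The semidirect product `ℤ[Γ] ⋊ Γ`, where `Γ` acts on `ℤ[Γ]` by left multiplication. -/
abbrev GroupRingSemidirect (Γ : Type v) [Group Γ] : Type v :=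
  Multiplicative (MonoidAlgebra ℤ Γ) ⋊[leftMul Γ] Γ

/-- A lift `π → ℤ[Γ] ⋊ Γ` of the homomorphism `h : π → Γ` is nontrivial if its image meets
`ℤ[Γ] × {e}` in more than the neutral element. -/
def IsNontrivialLift {π : Type u} [Group π] {Γ : Type v} [Group Γ] (h : π →* Γ)
    (l : π →* GroupRingSemidirect Γ) : Prop :=
  SemidirectProduct.rightHom.comp l = h ∧
    (l.range : Set (GroupRingSemidirect Γ)) ∩ {x | x.right = 1} ≠ {1}

end TwistedAlexander

end

/-! Write Λ = ℤ[t, t⁻¹], Γ = G × ℤ, F = f × φ and π = π₁(X). The order of a finitely generated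
Λ-module is zero exactly when the module has an element that is not torsion (`isOrder_eq_zero_iff`).
A lift of F to ℤ[Γ] ⋊ Γ is a derivation d : π → ℤ[Γ] along F, and it is nontrivial exactly when d k
≠ 0 for some k in ker F (`exists_isNontrivialLift_iff`). The bridge between the two is that ℤ[Γ] is
the Λ-dual of Λ^G, with left multiplication adjoint to the action on the coefficients
(`groupRingPairing`). Hence derivations are 1-cocycles with values in the dual of the coefficient
module.

Given d and k, join p to k • p by a path γ in the covering. As k acts trivially on coefficients, m ⊗
γ is a cycle. The derivation induces a Λ-linear functional on 1-chains that kills boundaries and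
takes the value ⟨d k, m⟩ on this cycle. This is nonzero for a suitable m, so the class is not
torsion.

Conversely, simple connectivity of the covering makes the class of a path modulo boundaries depend
on its end points only. This embeds H₁ in the module generated by all m ⊗ (p → g • p), which is
finitely generated because π is. A functional l on it that is nonzero at a given non-torsion class
restricts to a derivation d. If d vanished on ker F, it would come from F(π) and would be the
coboundary of an additive map Λ^G → Λ, because Hom_ℤ(ℤ[Γ], Λ) is coinduced. Then l would factor
through the boundary and vanish on cycles, a contradiction.

The topological input is that a finite CW complex is compact, locally path connected and locally
inessential. These give the simply connected covering and the finite generation of π. -/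

noncomputable section

namespace TwistedAlexander

section

open Set Metric Topology unitInterval

/-! ### Local topology of finite CW complexes -/

section CW

/-- A set is inessential if any two paths in it with the same end points are homotopic in the
ambient space. -/
def IsInessential {X : Type*} [TopologicalSpace X] (U : Set X) : Prop :=
  ∀ ⦃a b : X⦄ (γ δ : Path a b), range γ ⊆ U → range δ ⊆ U → γ.Homotopic δ

theorem IsInessential.mono {X : Type*} [TopologicalSpace X] {U V : Set X} (hV : IsInessential V)
    (h : U ⊆ V) : IsInessential U :=
  fun _ _ γ δ hγ hδ => hV γ δ (hγ.trans h) (hδ.trans h)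

/-- The tracks of the end points under `H` conjugate the image of a path under `f` into its image
under `g`, and they cancel in the fundamental groupoid. -/
theorem homotopic_map_of_homotopy {X Y : Type*} [TopologicalSpace X] [TopologicalSpace Y]
    {f g : C(X, Y)} (H : f.Homotopy g) {a b : X} (γ δ : Path a b)
    (h : (γ.map g.continuous).Homotopic (δ.map g.continuous)) :
    (γ.map f.continuous).Homotopic (δ.map f.continuous) := by
  have h1 := Path.Homotopic.map_trans_evalAt H γ
  have h2 := Path.Homotopic.map_trans_evalAt H δ
  have h3 := (h1.trans (Path.Homotopic.hcomp (Path.Homotopic.refl _) h)).trans h2.symm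
  have h4 := h3.hcomp (Path.Homotopic.refl (H.evalAt b).symm)
  have key : ∀ p : Path (f a) (f b),
      ((p.trans (H.evalAt b)).trans (H.evalAt b).symm).Homotopic p := fun p =>
    (Path.Homotopic.trans ⟨Path.Homotopy.transAssoc _ _ _⟩
      ((Path.Homotopic.refl p).hcomp
        ⟨(Path.Homotopy.reflTransSymm (H.evalAt b)).symm⟩)).trans ⟨Path.Homotopy.transRefl p⟩
  exact (key _).symm.trans (h4.trans (key _))

/-- A closed map restricts to a quotient map over any subset of its range. This lets continuity on a
cell be tested in the ball. -/
theorem continuousOn_of_isClosedMap {E Y Z : Type*} [TopologicalSpace E] [TopologicalSpace Y]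
    [TopologicalSpace Z] {q : E → Y} (hq : IsClosedMap q) {T : Set Y} (hT : T ⊆ range q)
    {h : Y → Z} (hc : ContinuousOn (h ∘ q) (q ⁻¹' T)) : ContinuousOn h T := by
  rw [continuousOn_iff_isClosed] at hc ⊢
  intro C hC
  obtain ⟨u, hu, hu'⟩ := hc C hC
  refine ⟨q '' u, hq u hu, ?_⟩
  ext y
  constructor
  · rintro ⟨hy, hyT⟩
    obtain ⟨e, rfl⟩ := hT hyT
    have : e ∈ u ∩ q ⁻¹' T := hu' ▸ ⟨hy, hyT⟩
    exact ⟨⟨e, this.1, rfl⟩, hyT⟩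
  · rintro ⟨⟨e, he, rfl⟩, hyT⟩
    have : e ∈ h ∘ q ⁻¹' C ∩ q ⁻¹' T := hu' ▸ ⟨he, hyT⟩
    exact ⟨this.1, hyT⟩

open Topology.RelCWComplex

variable {X : Type u} [TopologicalSpace X] [Topology.CWComplex (Set.univ : Set X)]

/-- The sum of all characteristic maps. -/
def characteristicMap (p : Σ c : (Σ n, cell (univ : Set X) n), closedBall (0 : Fin c.1 → ℝ) 1) :
    X :=
  map p.1.1 p.1.2 p.2.1

theorem continuous_characteristicMap : Continuous (characteristicMap (X := X)) :=
  continuous_sigma fun c => (continuousOn c.1 c.2).domRestrict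

theorem surjective_characteristicMap : Function.Surjective (characteristicMap (X := X)) := by
  intro x
  have hx : x ∈ ⋃ (n : ℕ) (j : cell (univ : Set X) n), closedCell n j := by
    rw [CWComplex.union]; trivial
  simp only [mem_iUnion] at hx
  obtain ⟨n, j, v, hv, rfl⟩ := hx
  exact ⟨⟨⟨n, j⟩, ⟨v, hv⟩⟩, rfl⟩

/-- The characteristic map identifies the open cell with a convex ball, where the straight-line
homotopy is available. -/
theorem isInessential_openCell (n : ℕ) (j : cell (univ : Set X) n) :
    IsInessential (openCell n j) := by
  intro a b γ δ hγ hδ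
  have htgt : ∀ y ∈ openCell n j, y ∈ (map (C := (univ : Set X)) n j).target := by
    rintro _ ⟨v, hv, rfl⟩
    exact (map n j).map_source (by rwa [source_eq])
  have hball : ∀ y ∈ openCell n j, (map (C := (univ : Set X)) n j).symm y ∈
      ball (0 : Fin n → ℝ) 1 := fun y hy => by
    rw [← source_eq (C := (univ : Set X)) n j]
    exact (map n j).map_target (htgt y hy)
  have hinv : ∀ y ∈ openCell n j, map n j ((map (C := (univ : Set X)) n j).symm y) = y :=
    fun y hy => (map n j).right_inv (htgt y hy)
  have hc : ∀ p : Path a b, range p ⊆ openCell n j →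
      Continuous fun t => (map (C := (univ : Set X)) n j).symm (p t) := fun p hp =>
    (continuousOn_symm n j).comp_continuous p.continuous fun t => htgt _ (hp ⟨t, rfl⟩)
  have h1 := hc γ hγ
  have h2 := hc δ hδ
  have hγ' : ∀ t, γ t ∈ openCell n j := fun t => hγ ⟨t, rfl⟩
  have hδ' : ∀ t, δ t ∈ openCell n j := fun t => hδ ⟨t, rfl⟩
  have hconv : ∀ x : I × I, (1 - (x.1 : ℝ)) • (map (C := (univ : Set X)) n j).symm (γ x.2) +
      (x.1 : ℝ) • (map (C := (univ : Set X)) n j).symm (δ x.2) ∈ ball (0 : Fin n → ℝ) 1 :=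
    fun x => convex_ball _ _ (hball _ (hγ' _)) (hball _ (hδ' _)) (by unit_interval)
      (by unit_interval) (by ring)
  refine ⟨⟨⟨⟨fun x => map n j ((1 - (x.1 : ℝ)) • (map (C := (univ : Set X)) n j).symm (γ x.2) +
      (x.1 : ℝ) • (map (C := (univ : Set X)) n j).symm (δ x.2)), ?_⟩, ?_, ?_⟩, ?_⟩⟩
  · have h1' := h1.comp (continuous_snd (X := I) (Y := I))
    have h2' := h2.comp (continuous_snd (X := I) (Y := I))
    refine (continuousOn n j).comp_continuous ?_
      fun x => ball_subset_closedBall (hconv x)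
    have h3 : Continuous fun x : I × I => (x.1 : ℝ) := by fun_prop
    exact ((continuous_const.sub h3).smul h1').add (h3.smul h2')
  · intro t
    simp [hinv _ (hγ' t)]
  · intro t
    simp [hinv _ (hδ' t)]
  · rintro t x (rfl | rfl)
    · have := hγ' 0
      rw [γ.source] at this
      simp [← add_smul, hinv a this]
    · have := hγ' 1
      rw [γ.target] at this
      simp [← add_smul, hinv b this]

open Classical in
/-- The radial deformation that pushes an open `n`-cell without its centre to the frontier and
fixes the points outside of the open `n`-cells. -/
def radialPush (n : ℕ) (y : X) (s : ℝ) : X :=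
  if h : ∃ j : cell (univ : Set X) n, y ∈ openCell (C := (univ : Set X)) n j then
    map n h.choose ((1 - s + s * ‖(map n h.choose).symm y‖⁻¹) • (map n h.choose).symm y)
  else y

theorem radialPush_of_notMem {n : ℕ} {y : X}
    (h : ∀ j : cell (univ : Set X) n, y ∉ openCell n j) (s : ℝ) : radialPush n y s = y := by
  rw [radialPush, dif_neg (by simpa using h)]

theorem radialPush_map [T2Space X] {n : ℕ} (j : cell (univ : Set X) n) {v : Fin n → ℝ}
    (hv : v ∈ closedBall 0 1) (s : ℝ) :
    radialPush n (map n j v) s = map n j ((1 - s + s * ‖v‖⁻¹) • v) := by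
  rcases (mem_closedBall_zero_iff.1 hv).lt_or_eq with h | h
  · have hv' : v ∈ ball (0 : Fin n → ℝ) 1 := by simpa using h
    have hex : ∃ i : cell (univ : Set X) n, map n j v ∈ openCell n i := ⟨j, v, hv', rfl⟩
    have hj : hex.choose = j := by
      have := eq_of_not_disjoint_openCell
        (not_disjoint_iff.2 ⟨_, hex.choose_spec, ⟨v, hv', rfl⟩⟩ :
          ¬Disjoint (openCell n hex.choose) (openCell n j))
      simpa using this
    have hs : (map (C := (univ : Set X)) n j).symm (map n j v) = v :=
      (map n j).left_inv (by rwa [source_eq])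
    rw [radialPush, dif_pos hex, hj, hs]
  -- For `‖v‖ = 1` the scalar is 1, and the point lies in the lower skeleton, which the deformation
  -- fixes.
  · have hfr : map n j v ∈ cellFrontier n j := ⟨v, by simpa using h, rfl⟩
    rw [radialPush_of_notMem, h]
    · simp
    · intro i hi
      exact disjoint_left.1 (disjoint_skeletonLT_openCell le_rfl)
        (cellFrontier_subset_skeletonLT n j hfr) hi

/-- The `n`-skeleton without the centres of the `n`-cells. -/
def puncturedSkeleton (X : Type u) [TopologicalSpace X] [T2Space X]
    [Topology.CWComplex (Set.univ : Set X)] (n : ℕ) : Set X :=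
  {y | y ∈ skeletonLT (univ : Set X) (n + 1) ∧ ∀ j : cell (univ : Set X) n, y ≠ map n j 0}

theorem radialPush_one_mem [T2Space X] {n : ℕ} {y : X} (hy : y ∈ puncturedSkeleton X n) :
    radialPush n y 1 ∈ skeletonLT (univ : Set X) n := by
  by_cases h : ∃ j : cell (univ : Set X) n, y ∈ openCell (C := (univ : Set X)) n j
  · obtain ⟨j, v, hv, rfl⟩ := h
    rw [radialPush_map j (ball_subset_closedBall hv)]
    refine cellFrontier_subset_skeletonLT n j ⟨_, ?_, rfl⟩
    have : v ≠ 0 := fun h => hy.2 j (by rw [h])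
    simp [norm_smul, this]
  · push Not at h
    rw [radialPush_of_notMem h]
    have := hy.1
    rw [← SetLike.mem_coe, ← skeletonLT_union_iUnion_closedCell_eq_skeletonLT_succ] at this
    rcases this with h' | h'
    · exact h'
    · simp only [mem_iUnion] at h'
      obtain ⟨j, hj⟩ := h'
      rw [← cellFrontier_union_openCell_eq_closedCell] at hj
      exact cellFrontier_subset_skeletonLT n j (hj.resolve_right (h j))

variable [Topology.CWComplex.Finite (Set.univ : Set X)]

variable (X) in
theorem finite_cells : Finite (Σ n, cell (univ : Set X) n) :=
  RelCWComplex.finite_iff_finite_cells.1 inferInstance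

variable (X) in
theorem compactSpace_of_finite : CompactSpace X := by
  have := finite_cells X
  have : ∀ c : (Σ n, cell (univ : Set X) n), CompactSpace (closedBall (0 : Fin c.1 → ℝ) 1) :=
    fun c => isCompact_iff_compactSpace.1 (isCompact_closedBall _ _)
  refine ⟨?_⟩
  rw [← (surjective_characteristicMap (X := X)).range_eq]
  exact isCompact_range continuous_characteristicMap

variable [T2Space X]

variable (X) in
-- The space is a quotient of a finite disjoint union of closed balls, which are convex. Local path
-- connectedness passes to quotients.
theorem locallyPathConnectedSpace_of_finite : LocallyPathConnectedSpace X := by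
  have := finite_cells X
  have : ∀ c : (Σ n, cell (univ : Set X) n), CompactSpace (closedBall (0 : Fin c.1 → ℝ) 1) :=
    fun c => isCompact_iff_compactSpace.1 (isCompact_closedBall _ _)
  have : ∀ c : (Σ n, cell (univ : Set X) n),
      LocallyPathConnectedSpace (closedBall (0 : Fin c.1 → ℝ) 1) :=
    fun c => (convex_closedBall _ _).locallyPathConnectedSpace
  have hq : IsQuotientMap (characteristicMap (X := X)) :=
    continuous_characteristicMap.isClosedMap.isQuotientMap continuous_characteristicMap
      surjective_characteristicMap
  exact hq.locallyPathConnectedSpace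

/-- The lower skeleton and the closed `n`-cells form a finite closed cover of the `n`-skeleton, so
continuity on each piece suffices. On a cell it descends from the punctured ball. -/
theorem continuous_radialPush (n : ℕ) :
    Continuous fun p : puncturedSkeleton X n × I => radialPush n p.1.1 p.2 := by
  have := finite_cells X
  have : Finite (cell (univ : Set X) n) :=
    Finite.of_injective (fun j => (⟨n, j⟩ : Σ n, cell (univ : Set X) n))
      (fun i j h => by simpa using h)
  let C : Option (cell (univ : Set X) n) → Set X := fun o =>
    o.elim (skeletonLT (univ : Set X) n) (closedCell n)
  have hcl : ∀ o, IsClosed (C o)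
    | none => (skeletonLT (univ : Set X) n).closed
    | some j => isClosed_closedCell
  have hcont : ∀ o, ContinuousOn (fun p : X × I => radialPush n p.1 p.2)
      ((C o ∩ puncturedSkeleton X n) ×ˢ univ)
    | none => by
      refine continuous_fst.continuousOn.congr ?_
      rintro ⟨y, s⟩ ⟨⟨hy, -⟩, -⟩
      exact radialPush_of_notMem
        (fun j hj => disjoint_left.1 (disjoint_skeletonLT_openCell le_rfl) hy hj) _
    | some j => by
      have : CompactSpace (closedBall (0 : Fin n → ℝ) 1) :=
        isCompact_iff_compactSpace.1 (isCompact_closedBall _ _)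
      have hm : Continuous fun v : closedBall (0 : Fin n → ℝ) 1 =>
        map (C := (univ : Set X)) n j v := (continuousOn n j).domRestrict
      let q : closedBall (0 : Fin n → ℝ) 1 × I → X × I := fun p => (map n j p.1, p.2)
      have hq : Continuous q := (hm.comp continuous_fst).prodMk continuous_snd
      refine continuousOn_of_isClosedMap hq.isClosedMap ?_ ?_
      · rintro ⟨y, s⟩ ⟨⟨⟨v, hv, rfl⟩, -⟩, -⟩
        exact ⟨(⟨v, hv⟩, s), rfl⟩
      · have hne : ∀ p ∈ q ⁻¹' ((C (some j) ∩ puncturedSkeleton X n) ×ˢ univ),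
            ‖(p.1 : Fin n → ℝ)‖ ≠ 0 := by
          rintro ⟨⟨v, hv⟩, s⟩ ⟨⟨-, h⟩, -⟩ h0
          have h0' : v = 0 := by simpa using h0
          exact h.2 j (by simp [q, h0'])
        have : ContinuousOn (fun p : closedBall (0 : Fin n → ℝ) 1 × I =>
            map (C := (univ : Set X)) n j
              ((1 - (p.2 : ℝ) + (p.2 : ℝ) * ‖(p.1 : Fin n → ℝ)‖⁻¹) • (p.1 : Fin n → ℝ)))
            (q ⁻¹' ((C (some j) ∩ puncturedSkeleton X n) ×ˢ univ)) := by
          refine (continuousOn n j).comp ?_ ?_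
          · have h4 : Continuous fun p : closedBall (0 : Fin n → ℝ) 1 × I => (p.1 : Fin n → ℝ) := by
              fun_prop
            refine ContinuousOn.smul (f := fun p : closedBall (0 : Fin n → ℝ) 1 × I =>
              1 - (p.2 : ℝ) + (p.2 : ℝ) * ‖(p.1 : Fin n → ℝ)‖⁻¹) ?_ h4.continuousOn
            have h3 : Continuous fun p : closedBall (0 : Fin n → ℝ) 1 × I => (p.2 : ℝ) := by
              fun_prop
            refine (continuous_const.sub h3).continuousOn.add (h3.continuousOn.mul ?_)
            exact ContinuousOn.inv₀ (by fun_prop) hne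
          -- The scaled vector has norm `(1 - s)‖v‖ + s ≤ 1`.
          · intro p hp
            have h0 := hne p hp
            have h1 : ‖(p.1 : Fin n → ℝ)‖ ≤ 1 := mem_closedBall_zero_iff.1 p.1.2
            have h2 : (0 : ℝ) ≤ p.2 := p.2.2.1
            have h3 : (p.2 : ℝ) ≤ 1 := p.2.2.2
            rw [mem_closedBall_zero_iff, norm_smul, Real.norm_of_nonneg]
            · rw [add_mul, mul_assoc, inv_mul_cancel₀ h0]
              nlinarith [norm_nonneg (p.1 : Fin n → ℝ)]
            · have : 0 ≤ ‖(p.1 : Fin n → ℝ)‖⁻¹ := by positivity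
              nlinarith [mul_nonneg h2 this]
        refine this.congr ?_
        rintro ⟨⟨v, hv⟩, s⟩ -
        exact radialPush_map j hv s
  refine (locallyFinite_of_finite
    fun o => (fun p : puncturedSkeleton X n × I => p.1.1) ⁻¹' C o).continuous ?_
    (fun o => (hcl o).preimage (by fun_prop)) ?_
  · refine eq_univ_of_forall fun p => ?_
    have := p.1.2.1
    rw [← SetLike.mem_coe, ← skeletonLT_union_iUnion_closedCell_eq_skeletonLT_succ] at this
    rcases this with h' | h'
    · exact mem_iUnion.2 ⟨none, h'⟩
    · obtain ⟨j, hj⟩ := mem_iUnion.1 h'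
      exact mem_iUnion.2 ⟨some j, hj⟩
  · intro o
    exact (hcont o).comp (f := fun p : puncturedSkeleton X n × I => (p.1.1, p.2))
      (by fun_prop) fun p hp => ⟨⟨hp, p.1.2⟩, trivial⟩

/-- Induction over skeleta. A point in an open top cell has that cell as a neighbourhood within the
skeleton. Near any other point, the radial deformation carries paths to the lower skeleton without
changing whether they are homotopic in `X`. -/
theorem exists_isInessential_skeletonLT (n : ℕ) :
    ∀ x ∈ skeletonLT (univ : Set X) n, ∃ U : Set X, IsOpen U ∧ x ∈ U ∧
      IsInessential (U ∩ skeletonLT (univ : Set X) n) := by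
  have := finite_cells X
  induction n with
  | zero =>
    intro x hx
    have := CWComplex.skeletonLT_zero_eq_empty (C := (univ : Set X))
    rw [← SetLike.mem_coe] at hx
    simp [this] at hx
  | succ n ih =>
    have : Finite (cell (univ : Set X) n) :=
      Finite.of_injective (fun j => (⟨n, j⟩ : Σ n, cell (univ : Set X) n))
        (fun i j h => by simpa using h)
    intro x hx
    have hsk := skeletonLT_union_iUnion_closedCell_eq_skeletonLT_succ (C := (univ : Set X)) n
    by_cases h : ∃ j : cell (univ : Set X) n, x ∈ openCell n j
    · obtain ⟨j, hj⟩ := h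
      have hnot : ∀ y ∈ openCell n j, y ∉ (skeletonLT (univ : Set X) n : Set X) ∪
          ⋃ i : {i : cell (univ : Set X) n // i ≠ j}, closedCell n i.1 := by
        rintro y hy (h' | h')
        · exact disjoint_left.1 (disjoint_skeletonLT_openCell le_rfl) h' hy
        · obtain ⟨⟨i, hi⟩, h'⟩ := mem_iUnion.1 h'
          rw [← cellFrontier_union_openCell_eq_closedCell] at h'
          rcases h' with h' | h'
          · exact disjoint_left.1 (disjoint_skeletonLT_openCell le_rfl)
              (cellFrontier_subset_skeletonLT n i h') hy
          · have := eq_of_not_disjoint_openCell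
              (not_disjoint_iff.2 ⟨y, h', hy⟩ : ¬Disjoint (openCell n i) (openCell n j))
            exact hi (by simpa using this)
      refine ⟨((skeletonLT (univ : Set X) n : Set X) ∪
          ⋃ i : {i : cell (univ : Set X) n // i ≠ j}, closedCell n i.1)ᶜ, ?_, hnot x hj, ?_⟩
      · exact ((skeletonLT (univ : Set X) n).closed.union
          (isClosed_iUnion_of_finite fun i => isClosed_closedCell)).isOpen_compl
      · refine (isInessential_openCell n j).mono ?_
        rintro y ⟨hy, hy'⟩
        push_cast at hy'
        rw [← hsk] at hy'
        simp only [mem_compl_iff, mem_union, mem_iUnion, not_or, not_exists] at hy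
        rcases hy' with h' | h'
        · exact absurd h' hy.1
        · obtain ⟨i, hi⟩ := mem_iUnion.1 h'
          by_cases hij : i = j
          · subst hij
            rw [← cellFrontier_union_openCell_eq_closedCell] at hi
            exact hi.resolve_left fun h => hy.1 (cellFrontier_subset_skeletonLT n i h)
          · exact absurd hi (hy.2 ⟨i, hij⟩)
    · push Not at h
      have hxK : x ∈ puncturedSkeleton X n :=
        ⟨by exact_mod_cast hx, fun j hj => h j (hj ▸ map_zero_mem_openCell n j)⟩
      obtain ⟨V, hV, hxV, hVe⟩ := ih (radialPush n x 1) (radialPush_one_mem hxK)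
      let H : ContinuousMap.Homotopy (⟨Subtype.val, continuous_subtype_val⟩ :
          C(puncturedSkeleton X n, X))
          ⟨fun y => radialPush n y.1 1, (continuous_radialPush (X := X) n).comp
            (Continuous.prodMk continuous_id (continuous_const (y := (1 : I))))⟩ :=
        { toFun := fun p => radialPush n p.2.1 p.1
          continuous_toFun := (continuous_radialPush (X := X) n).comp continuous_swap
          map_zero_left := fun y => by
            by_cases h : ∃ j : cell (univ : Set X) n, y.1 ∈ openCell n j
            · obtain ⟨j, v, hv, hy⟩ := h
              simp [← hy, radialPush_map j (ball_subset_closedBall hv)]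
            · push Not at h
              simp [radialPush_of_notMem h]
          map_one_left := fun y => rfl }
      -- The preimage of `V` under the final push is open only in the punctured skeleton; `W`
      -- extends it to an open set of `X`. Removing the finitely many centres later makes the push
      -- defined on all of its trace.
      obtain ⟨W, hW, hWV⟩ := isOpen_induced_iff.1 (hV.preimage
        ((continuous_radialPush (X := X) n).comp
          (Continuous.prodMk continuous_id (continuous_const (y := (1 : I))))))
      have hWV' : ∀ y (hy : y ∈ puncturedSkeleton X n), y ∈ W ↔ radialPush n y 1 ∈ V :=
        fun y hy => Set.ext_iff.1 hWV ⟨y, hy⟩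
      refine ⟨W ∩ (range fun j : cell (univ : Set X) n => map n j 0)ᶜ,
        hW.inter (finite_range _).isClosed.isOpen_compl,
        ⟨(hWV' x hxK).2 hxV, fun ⟨j, hj⟩ => hxK.2 j hj.symm⟩, ?_⟩
      intro a b γ δ hγ hδ
      have key : ∀ p : Path a b, range p ⊆ W ∩ (range fun j : cell (univ : Set X) n => map n j 0)ᶜ ∩
          skeletonLT (univ : Set X) (n + 1 : ℕ) → ∀ t, p t ∈ puncturedSkeleton X n ∩ W :=
        fun p hp t => ⟨⟨by exact_mod_cast (hp ⟨t, rfl⟩).2,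
          fun j hj => (hp ⟨t, rfl⟩).1.2 ⟨j, hj.symm⟩⟩, (hp ⟨t, rfl⟩).1.1⟩
      have hkγ := key γ hγ
      have hkδ := key δ hδ
      have ha : a ∈ puncturedSkeleton X n := by simpa using (hkγ 0).1
      have hb : b ∈ puncturedSkeleton X n := by simpa using (hkγ 1).1
      let γ' : Path (⟨a, ha⟩ : puncturedSkeleton X n) ⟨b, hb⟩ :=
        ⟨⟨fun t => ⟨γ t, (hkγ t).1⟩, by fun_prop⟩, by simp, by simp⟩
      let δ' : Path (⟨a, ha⟩ : puncturedSkeleton X n) ⟨b, hb⟩ :=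
        ⟨⟨fun t => ⟨δ t, (hkδ t).1⟩, by fun_prop⟩, by simp, by simp⟩
      refine homotopic_map_of_homotopy H γ' δ' (hVe _ _ ?_ ?_)
      · rintro _ ⟨t, rfl⟩
        exact ⟨(hWV' _ (hkγ t).1).1 (hkγ t).2, radialPush_one_mem (hkγ t).1⟩
      · rintro _ ⟨t, rfl⟩
        exact ⟨(hWV' _ (hkδ t).1).1 (hkδ t).2, radialPush_one_mem (hkδ t).1⟩

theorem exists_isInessential_nhd (x : X) : ∃ U : Set X, IsOpen U ∧ x ∈ U ∧ IsInessential U := by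
  obtain ⟨N, hN⟩ := Filter.eventually_atTop.1
    (RelCWComplex.FiniteDimensional.eventually_isEmpty_cell (C := (univ : Set X)) (D := ∅))
  have hall : ∀ y : X, y ∈ skeletonLT (univ : Set X) N := fun y => by
    have hy : y ∈ ⋃ (n : ℕ) (j : cell (univ : Set X) n), openCell n j := by
      rw [CWComplex.iUnion_openCell_eq_complex]; trivial
    simp only [mem_iUnion] at hy
    obtain ⟨n, j, hj⟩ := hy
    refine CWComplex.mem_skeletonLT_iff.2 ⟨n, ?_, j, hj⟩
    by_contra h
    exact (hN n (by simpa using h)).false j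
  obtain ⟨U, hU, hx, hUi⟩ := exists_isInessential_skeletonLT N x (hall x)
  exact ⟨U, hU, hx, hUi.mono fun y hy => ⟨hy, hall y⟩⟩

end CW

end

section

open Set Topology unitInterval

/-! ### The universal covering is a simply connected covering -/

section GroupAction

open scoped Pointwise

/-- A group that acts on a connected space is finitely generated if finitely many open sets, whose
translates cover the space, meet only finitely many translates of each other. -/
theorem group_fg_of_action {Γ : Type*} {Y : Type*} [Group Γ] [TopologicalSpace Y]
    [ConnectedSpace Y] [MulAction Γ Y] [ContinuousConstSMul Γ Y] {ι : Type*} [Finite ι]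
    (D : ι → Set Y) (hopen : ∀ i, IsOpen (D i)) (hcover : ∀ y, ∃ i, ∃ g : Γ, y ∈ g • D i)
    (hfin : ∀ i j, {g : Γ | (g • D j ∩ D i).Nonempty}.Finite) : Group.FG Γ := by
  -- This finite set generates: the translates by its closure form an open set `E`. A translate that
  -- meets `E` is contained in `E`, so the complement is open too, and connectedness gives `E =
  -- univ`.
  let S : Set Γ := ⋃ i, ⋃ j, {g : Γ | (g • D j ∩ D i).Nonempty}
  have hS : S.Finite := finite_iUnion fun i => finite_iUnion fun j => hfin i j
  let E : Set Y := ⋃ h : Subgroup.closure S, ⋃ i, (h : Γ) • D i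
  have key : ∀ (g : Γ) (h : Subgroup.closure S) i j,
      (g • D j ∩ (h : Γ) • D i).Nonempty → g ∈ Subgroup.closure S := by
    rintro g h i j ⟨y, hy, hy'⟩
    have : (h : Γ)⁻¹ * g ∈ Subgroup.closure S := by
      refine Subgroup.subset_closure (mem_iUnion.2 ⟨i, mem_iUnion.2 ⟨j, (h : Γ)⁻¹ • y, ?_, ?_⟩⟩)
      · rw [mul_smul]; exact smul_mem_smul_set hy
      · exact mem_smul_set_iff_inv_smul_mem.1 hy'
    simpa using mul_mem h.2 this
  have hE : IsClopen E := by
    refine ⟨⟨?_⟩, isOpen_iUnion fun h => isOpen_iUnion fun i => (hopen i).smul (h : Γ)⟩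
    rw [isOpen_iff_forall_mem_open]
    intro y hy
    obtain ⟨j, g, hg⟩ := hcover y
    refine ⟨g • D j, fun z hz hzE => hy ?_, (hopen j).smul g, hg⟩
    simp only [E, mem_iUnion] at hzE ⊢
    obtain ⟨h, i, hi⟩ := hzE
    exact ⟨⟨g, key g h i j ⟨z, hz, hi⟩⟩, j, hg⟩
  obtain ⟨y⟩ := (inferInstance : Nonempty Y)
  obtain ⟨j, g, hg⟩ := hcover y
  rw [mem_smul_set_iff_inv_smul_mem] at hg
  have hEu : E = univ := hE.eq_univ
    ⟨g⁻¹ • y, mem_iUnion.2 ⟨1, mem_iUnion.2 ⟨j, by simpa using hg⟩⟩⟩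
  refine ⟨⟨hS.toFinset, ?_⟩⟩
  rw [Set.Finite.coe_toFinset, eq_top_iff]
  rintro g' -
  have : g' • g⁻¹ • y ∈ E := hEu ▸ mem_univ _
  simp only [E, mem_iUnion] at this
  obtain ⟨h, i, hi⟩ := this
  exact key g' h i j ⟨_, smul_mem_smul_set hg, hi⟩

end GroupAction

/-! ### Deck transformations, path lifting and finite generation of the fundamental group -/

section Cover

variable {X : Type u} [TopologicalSpace X] {x₀ : X}

theorem trans_refl' {a b : X} (p : Path.Homotopic.Quotient a b) :
    p.trans (Path.Homotopic.Quotient.refl b) = p :=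
  CategoryTheory.Category.comp_id (X := FundamentalGroupoid.mk a)
    (Y := FundamentalGroupoid.mk b) p

theorem trans_symm' {a b : X} (p : Path.Homotopic.Quotient a b) :
    p.trans p.symm = Path.Homotopic.Quotient.refl a :=
  CategoryTheory.Groupoid.comp_inv (X := FundamentalGroupoid.mk a)
    (Y := FundamentalGroupoid.mk b) p

theorem symm_trans' {a b : X} (p : Path.Homotopic.Quotient a b) :
    p.symm.trans p = Path.Homotopic.Quotient.refl b :=
  CategoryTheory.Groupoid.inv_comp (X := FundamentalGroupoid.mk a)
    (Y := FundamentalGroupoid.mk b) p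

theorem trans_left_cancel' {a b c : X} {p : Path.Homotopic.Quotient a b}
    {q r : Path.Homotopic.Quotient b c} (h : p.trans q = p.trans r) : q = r := by
  rw [← refl_trans' q, ← symm_trans' p, trans_assoc', h, ← trans_assoc', symm_trans', refl_trans']

theorem trans_right_cancel' {a b c : X} {p q : Path.Homotopic.Quotient a b}
    {r : Path.Homotopic.Quotient b c} (h : p.trans r = q.trans r) : p = q := by
  rw [← trans_refl' p, ← trans_symm' r, ← trans_assoc', h, trans_assoc', trans_symm', trans_refl']

/-- The element of the fundamental group given by a class of loops. -/
def Pi1.ofLoop (c : Path.Homotopic.Quotient x₀ x₀) : Pi1 X x₀ :=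
  MulOpposite.op c

theorem Pi1.ext {g h : Pi1 X x₀} (e : g.loop = h.loop) : g = h :=
  MulOpposite.unop_injective e

theorem UniversalCover.ext {p q : UniversalCover x₀} (h : p.1 = q.1)
    (h' : p.2.cast rfl h.symm = q.2) : p = q := by
  obtain ⟨x, p⟩ := p
  obtain ⟨y, q⟩ := q
  obtain rfl : x = y := h
  rw [Path.Homotopic.Quotient.cast_rfl_rfl] at h'
  exact congrArg _ h'

theorem eq_one_of_smul_eq {g : Pi1 X x₀} {p : UniversalCover x₀} (h : g • p = p) : g = 1 := by
  have h2 : (g • p).2 = p.2 := eq_of_heq (Sigma.ext_iff.1 h).2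
  rw [smul_snd] at h2
  refine Pi1.ext (trans_right_cancel' (r := p.2) (h2.trans (refl_trans' _).symm))

theorem exists_smul_eq {p q : UniversalCover x₀} (h : p.1 = q.1) : ∃ g : Pi1 X x₀, g • q = p := by
  obtain ⟨x, p⟩ := p
  obtain ⟨y, q⟩ := q
  obtain rfl : x = y := h
  refine ⟨Pi1.ofLoop (p.trans q.symm), Sigma.ext rfl (heq_of_eq ?_)⟩
  exact (trans_assoc' p q.symm q).trans (by rw [symm_trans', trans_refl'])

theorem isOpen_coverNhd {p : UniversalCover x₀} {U : Set X} (hU : IsOpen U) (hp : p.1 ∈ U) :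
    IsOpen (coverNhd p U) :=
  TopologicalSpace.isOpen_generateFrom_of_mem ⟨p, U, hU, hp, rfl⟩

theorem mem_coverNhd_self {p : UniversalCover x₀} {U : Set X} (hp : p.1 ∈ U) : p ∈ coverNhd p U :=
  ⟨Path.refl _, by simpa using hp, (trans_refl' _).symm⟩

theorem fst_mem_of_mem_coverNhd {p q : UniversalCover x₀} {U : Set X} (h : q ∈ coverNhd p U) :
    q.1 ∈ U := by
  obtain ⟨δ, hδ, -⟩ := h
  exact hδ ⟨1, δ.target⟩

theorem coverNhd_subset {p q : UniversalCover x₀} {U V : Set X} (h : q ∈ coverNhd p U)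
    (hV : V ⊆ U) : coverNhd q V ⊆ coverNhd p U := by
  rintro r ⟨δ, hδ, hr⟩
  obtain ⟨ε, hε, hq⟩ := h
  refine ⟨ε.trans δ, ?_, ?_⟩
  · rw [Path.trans_range]
    exact union_subset hε (hδ.trans hV)
  · rw [hr, hq, Path.Homotopic.Quotient.mk_trans, trans_assoc']

theorem coverNhd_injOn {p : UniversalCover x₀} {U : Set X} (hU : IsInessential U)
    {q r : UniversalCover x₀} (hq : q ∈ coverNhd p U) (hr : r ∈ coverNhd p U) (h : q.1 = r.1) :
    q = r := by
  obtain ⟨x, q⟩ := q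
  obtain ⟨y, r⟩ := r
  obtain rfl : x = y := h
  obtain ⟨δ, hδ, hq⟩ := hq
  obtain ⟨ε, hε, hr⟩ := hr
  have : Path.Homotopic.Quotient.mk δ = .mk ε := Path.Homotopic.Quotient.eq.2 (hU δ ε hδ hε)
  refine Sigma.ext rfl (heq_of_eq ?_)
  exact hq.trans ((congrArg _ this).trans hr.symm)

theorem isTopologicalBasis_coverNhd : TopologicalSpace.IsTopologicalBasis
    {S | ∃ (p : UniversalCover x₀) (U : Set X), IsOpen U ∧ p.1 ∈ U ∧ S = coverNhd p U} where
  exists_subset_inter := by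
    rintro _ ⟨p, U, hU, hp, rfl⟩ _ ⟨p', U', hU', hp', rfl⟩ q ⟨hq, hq'⟩
    have h1 := fst_mem_of_mem_coverNhd hq
    have h2 := fst_mem_of_mem_coverNhd hq'
    exact ⟨_, ⟨q, U ∩ U', hU.inter hU', ⟨h1, h2⟩, rfl⟩, mem_coverNhd_self ⟨h1, h2⟩,
      subset_inter (coverNhd_subset hq inter_subset_left)
        (coverNhd_subset hq' inter_subset_right)⟩
  sUnion_eq := eq_univ_of_forall fun p =>
    ⟨_, ⟨p, univ, isOpen_univ, trivial, rfl⟩, mem_coverNhd_self trivial⟩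
  eq_generateFrom := rfl

/-- Such a `g` is determined by the class of a path in `U ∪ V` from `p.1` to `q.1` through the
common point, and inessentiality leaves only one class. -/
theorem subsingleton_setOf_smul_coverNhd {p q : UniversalCover x₀} {U V : Set X}
    (h : (U ∩ V).Nonempty → IsInessential (U ∪ V)) :
    {g : Pi1 X x₀ | ∃ r ∈ coverNhd q V, g • r ∈ coverNhd p U}.Subsingleton := by
  rintro g ⟨r, hr, hr'⟩ g' ⟨s, hs, hs'⟩
  obtain ⟨δ, hδ, hrq⟩ := hr
  obtain ⟨ε, hε, hsq⟩ := hs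
  obtain ⟨δ', hδ', hrp⟩ := hr'
  obtain ⟨ε', hε', hsp⟩ := hs'
  have hUV := h ⟨r.1, hδ' ⟨1, δ'.target⟩, hδ ⟨1, δ.target⟩⟩
  have e1 : Path.Homotopic.Quotient.mk (δ'.trans δ.symm) = .mk (ε'.trans ε.symm) := by
    refine Path.Homotopic.Quotient.eq.2 (hUV _ _ ?_ ?_)
    · rw [Path.trans_range, Path.symm_range]
      exact union_subset_union hδ' hδ
    · rw [Path.trans_range, Path.symm_range]
      exact union_subset_union hε' hε
  have key : ∀ (k : Pi1 X x₀) (t : UniversalCover x₀) (α : Path q.1 t.1) (β : Path p.1 t.1),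
      t.2 = q.2.trans (.mk α) → k.loop.trans t.2 = p.2.trans (.mk β) →
      k.loop.trans q.2 = p.2.trans (.mk (β.trans α.symm)) := by
    intro k t α β h1 h2
    rw [Path.Homotopic.Quotient.mk_trans, ← trans_assoc', ← h2, h1,
      Path.Homotopic.Quotient.mk_symm, trans_assoc', trans_assoc', trans_symm', trans_refl']
  refine Pi1.ext (trans_right_cancel' (r := q.2) ?_)
  rw [key g r δ δ' hrq hrp, key g' s ε ε' hsq hsp, e1]

variable (x₀) in
/-- The covering projection. -/
def coverProj : C(UniversalCover x₀, X) where
  toFun := Sigma.fst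
  continuous_toFun := by
    refine continuous_def.2 fun U hU => isOpen_iff_forall_mem_open.2 fun p hp =>
      ⟨coverNhd p U, fun q hq => fst_mem_of_mem_coverNhd hq, isOpen_coverNhd hU hp,
        mem_coverNhd_self hp⟩

/-- The lift of a path to the universal covering. -/
def coverLift (p : UniversalCover x₀) {b : X} (γ : Path p.1 b) (t : I) : UniversalCover x₀ :=
  ⟨γ t, p.2.trans (Path.Homotopic.Quotient.mk ((γ.subpath 0 t).cast γ.source.symm rfl))⟩

theorem coverLift_mem_coverNhd (p : UniversalCover x₀) {b : X} (γ : Path p.1 b) (s t : I)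
    {U : Set X} (h : range (γ.subpath s t) ⊆ U) :
    coverLift p γ t ∈ coverNhd (coverLift p γ s) U := by
  refine ⟨γ.subpath s t, h, ?_⟩
  refine Eq.trans (congrArg (fun c => p.2.trans c) ?_) (trans_assoc' p.2 _ _).symm
  refine Eq.trans (Path.Homotopic.Quotient.eq.2 ?_).symm (Path.Homotopic.Quotient.mk_trans _ _)
  exact Path.Homotopic.pathCast ⟨Path.Homotopy.subpathTransSubpath γ 0 s t⟩ γ.source.symm rfl

theorem continuous_coverLift (p : UniversalCover x₀) {b : X} (γ : Path p.1 b) :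
    Continuous (coverLift p γ) := by
  refine continuous_generateFrom_iff.2 ?_
  rintro _ ⟨p', U, hU, hp', rfl⟩
  refine isOpen_iff_mem_nhds.2 fun t ht => ?_
  have htU : t ∈ γ ⁻¹' U := fst_mem_of_mem_coverNhd ht
  obtain ⟨ε, hε, hball⟩ := Metric.isOpen_iff.1 (hU.preimage γ.continuous) t htU
  refine Filter.mem_of_superset (Metric.ball_mem_nhds t hε) fun s hs => ?_
  refine coverNhd_subset ht subset_rfl (coverLift_mem_coverNhd p γ t s ?_)
  rw [Path.range_subpath]
  rintro _ ⟨r, hr, rfl⟩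
  refine hball ?_
  rw [Metric.mem_ball, dist_comm] at hs ⊢
  refine lt_of_le_of_lt ?_ hs
  rw [Subtype.dist_eq, Subtype.dist_eq, Real.dist_eq, Real.dist_eq]
  exact abs_sub_left_of_mem_uIcc (a := (t : ℝ)) (b := s) (c := r) (by
    rcases le_total t s with h | h
    · rw [uIcc_of_le h] at hr; exact Icc_subset_uIcc hr
    · rw [uIcc_of_ge h] at hr; exact Icc_subset_uIcc' hr) |> fun h => by
      rwa [abs_sub_comm (t : ℝ), abs_sub_comm (t : ℝ)]

theorem trans_cast' {a b c c' : X} (p : Path.Homotopic.Quotient a b)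
    (q : Path.Homotopic.Quotient b c) (h : c' = c) :
    (p.trans q).cast rfl h = p.trans (q.cast rfl h) := by
  subst h
  simp only [Path.Homotopic.Quotient.cast_rfl_rfl]

theorem coverLift_zero (p : UniversalCover x₀) {b : X} (γ : Path p.1 b) :
    coverLift p γ 0 = p := by
  refine UniversalCover.ext γ.source ((trans_cast' _ _ _).trans ?_)
  refine Eq.trans (congrArg (fun δ => p.2.trans (Path.Homotopic.Quotient.mk δ)) ?_)
    (trans_refl' p.2)
  ext s
  change γ.subpath 0 0 s = p.1
  simp

theorem coverLift_one (p : UniversalCover x₀) {b : X} (γ : Path p.1 b) :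
    coverLift p γ 1 = ⟨b, p.2.trans (Path.Homotopic.Quotient.mk γ)⟩ := by
  refine UniversalCover.ext γ.target ((trans_cast' _ _ _).trans ?_)
  refine congrArg (fun δ => p.2.trans (Path.Homotopic.Quotient.mk δ)) ?_
  ext s
  change γ.subpath 0 1 s = γ s
  simp

/-- The lift of a path to the universal covering, as a path. -/
def coverPath (p : UniversalCover x₀) {b : X} (γ : Path p.1 b) :
    Path p ⟨b, p.2.trans (Path.Homotopic.Quotient.mk γ)⟩ where
  toFun := coverLift p γ
  continuous_toFun := continuous_coverLift p γ
  source' := coverLift_zero p γ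
  target' := coverLift_one p γ

theorem nonempty_path (p q : UniversalCover x₀) : Nonempty (Path p q) := by
  obtain ⟨x, p⟩ := p
  obtain ⟨y, q⟩ := q
  obtain ⟨γ, hγ⟩ := Path.Homotopic.Quotient.mk_surjective (p.symm.trans q)
  have h := coverPath (⟨x, p⟩ : UniversalCover x₀) γ
  rw [hγ, ← trans_assoc', trans_symm', refl_trans'] at h
  exact ⟨h⟩

instance : PathConnectedSpace (UniversalCover x₀) where
  nonempty := ⟨⟨x₀, Path.Homotopic.Quotient.refl x₀⟩⟩
  joined := nonempty_path

variable [PathConnectedSpace X] [LocallyPathConnectedSpace X]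

variable (x₀) in
-- The image of a basic set is the path component of `p.1` in `U`, which is open by local path
-- connectedness.
theorem isQuotientMap_coverProj : IsQuotientMap (coverProj x₀) := by
  refine IsOpenMap.isQuotientMap ?_ (coverProj x₀).continuous ?_
  · refine isTopologicalBasis_coverNhd.isOpenMap_iff.2 ?_
    rintro _ ⟨p, U, hU, hp, rfl⟩
    convert hU.pathComponentIn p.1
    ext y
    constructor
    · rintro ⟨q, ⟨δ, hδ, -⟩, rfl⟩
      exact ⟨δ, fun t => hδ ⟨t, rfl⟩⟩
    · rintro ⟨δ, hδ⟩
      exact ⟨⟨y, p.2.trans (Path.Homotopic.Quotient.mk δ)⟩,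
        ⟨δ, by rintro _ ⟨t, rfl⟩; exact hδ t, rfl⟩, rfl⟩
  · intro x
    exact ⟨⟨x, Path.Homotopic.Quotient.mk (PathConnectedSpace.somePath x₀ x)⟩, rfl⟩

variable (x₀) in
theorem isCoveringMap_coverProj
    (hX : ∀ x : X, ∃ U : Set X, IsOpen U ∧ x ∈ U ∧ IsInessential U) :
    IsCoveringMap (coverProj x₀) := by
  have : IsQuotientCoveringMap (coverProj x₀) (Pi1 X x₀) :=
    { isQuotientMap_coverProj x₀ with
      apply_eq_iff_mem_orbit := fun {p q} =>
        ⟨fun h => exists_smul_eq h, by rintro ⟨g, rfl⟩; rfl⟩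
      disjoint := fun p => by
        obtain ⟨U, hU, hp, hUi⟩ := hX p.1
        refine ⟨coverNhd p U, (isOpen_coverNhd hU hp).mem_nhds (mem_coverNhd_self hp), ?_⟩
        rintro g ⟨_, ⟨q, hq, rfl⟩, hq'⟩
        exact eq_one_of_smul_eq (coverNhd_injOn hUi hq' hq rfl) }
  exact this.isCoveringMap

/-- By uniqueness of lifts, `α` is the explicit lift of its projection, whose end point is known. -/
theorem snd_eq_of_path (hX : ∀ x : X, ∃ U : Set X, IsOpen U ∧ x ∈ U ∧ IsInessential U)
    {p q : UniversalCover x₀} (α : Path p q) :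
    q.2 = p.2.trans (Path.Homotopic.Quotient.mk (α.map (coverProj x₀).continuous)) := by
  have h : (α : I → UniversalCover x₀) =
      coverLift p (α.map (coverProj x₀).continuous : Path p.1 q.1) := by
    refine (isCoveringMap_coverProj x₀ hX).eq_of_comp_eq α.continuous
      (continuous_coverLift _ _) rfl 0 ?_
    rw [Path.source, coverLift_zero]
  have h1 := congrFun h 1
  rw [Path.target, coverLift_one] at h1
  exact eq_of_heq (Sigma.ext_iff.1 h1).2

/-- The end point of a lift records the homotopy class of the projected path. Hence the projections
of `α` and `β` are homotopic, and a covering map reflects this. -/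
theorem homotopic_of_cover
    (hX : ∀ x : X, ∃ U : Set X, IsOpen U ∧ x ∈ U ∧ IsInessential U)
    {p q : UniversalCover x₀} (α β : Path p q) : α.Homotopic β := by
  refine Path.Homotopic.Quotient.eq.1
    ((isCoveringMap_coverProj x₀ hX).injective_path_homotopic_map p q ?_)
  exact trans_left_cancel' ((snd_eq_of_path hX α).symm.trans (snd_eq_of_path hX β))

/-- The fundamental group of a compact connected space which is locally nice is finitely
generated. -/
theorem fg_pi1 (hX : ∀ x : X, ∃ U : Set X, IsOpen U ∧ x ∈ U ∧ IsInessential U)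
    [T2Space X] [CompactSpace X] (x₀ : X) : Group.FG (Pi1 X x₀) := by
  let := uniformSpaceOfCompactR1 (γ := X)
  choose U hU hxU hUi using hX
  obtain ⟨V, hV, hVU⟩ := lebesgue_number_lemma isCompact_univ hU
    fun x _ => mem_iUnion.2 ⟨x, hxU x⟩
  -- Halving the Lebesgue entourage ensures that two members of the cover that meet lie together in
  -- one inessential set.
  obtain ⟨V', hV', hV'o, hV's, hVV⟩ := comp_open_symm_mem_uniformity_sets hV
  let W : X → Set X := fun x => pathComponentIn (UniformSpace.ball x V') x
  have hWo : ∀ x, IsOpen (W x) := fun x => (UniformSpace.isOpen_ball x hV'o).pathComponentIn x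
  have hxW : ∀ x, x ∈ W x := fun x =>
    mem_pathComponentIn_self (UniformSpace.mem_ball_self x hV')
  obtain ⟨T, hT⟩ := isCompact_univ.elim_finite_subcover W hWo fun x _ => mem_iUnion.2 ⟨x, hxW x⟩
  have hunion : ∀ x y, (W x ∩ W y).Nonempty → IsInessential (W x ∪ W y) := by
    rintro x y ⟨z, hzx, hzy⟩
    obtain ⟨i, hi⟩ := hVU z trivial
    refine (hUi i).mono (Subset.trans ?_ hi)
    have : ∀ w, z ∈ W w → W w ⊆ UniformSpace.ball z V := fun w hzw a ha =>
      by
      have h1 : (w, z) ∈ V' := pathComponentIn_subset (F := UniformSpace.ball w V') hzw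
      have h2 : (w, a) ∈ V' := pathComponentIn_subset (F := UniformSpace.ball w V') ha
      exact hVV ⟨w, hV's.symm _ _ h1, h2⟩
    exact union_subset (this x hzx) (this y hzy)
  let c : X → UniversalCover x₀ := fun x =>
    ⟨x, Path.Homotopic.Quotient.mk (PathConnectedSpace.somePath x₀ x)⟩
  refine group_fg_of_action (ι := T) (fun x : T => coverNhd (c x) (W x))
    (fun x => isOpen_coverNhd (hWo x) (hxW x)) ?_ ?_
  · intro p
    obtain ⟨x, hx, hp⟩ := mem_iUnion₂.1 (hT (mem_univ p.1))
    obtain ⟨δ, hδ⟩ := (isPathConnected_pathComponentIn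
      (UniformSpace.mem_ball_self x hV')).joinedIn x (hxW x) p.1 hp
    let q : UniversalCover x₀ := ⟨p.1, (c x).2.trans (Path.Homotopic.Quotient.mk δ)⟩
    obtain ⟨g, hg⟩ := exists_smul_eq (p := p) (q := q) rfl
    refine ⟨⟨x, hx⟩, g, mem_smul_set.2 ⟨q, ⟨δ, ?_, rfl⟩, hg⟩⟩
    rintro _ ⟨t, rfl⟩
    exact hδ t
  · intro i j
    refine Subsingleton.finite ?_
    refine (subsingleton_setOf_smul_coverNhd (p := c i) (q := c j) (hunion i j)).anti ?_
    rintro g ⟨_, ⟨r, hr, rfl⟩, hr'⟩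
    exact ⟨r, hr, hr'⟩

end Cover

end

section

open Set Topology unitInterval

/-! ### Singular one-chains modulo boundaries -/

section Chains

/-- The coordinates of a point of the standard simplex, as elements of the unit interval. -/
def simplexCoord {n : ℕ} (i : Fin (n + 1)) (x : stdSimplex ℝ (Fin (n + 1))) : I :=
  ⟨x i, stdSimplex.zero_le x i, stdSimplex.le_one x i⟩

theorem continuous_simplexCoord {n : ℕ} (i : Fin (n + 1)) :
    Continuous (simplexCoord (n := n) i) :=
  ((continuous_apply i).comp continuous_subtype_val).subtype_mk _

theorem faceInclusion_succAbove {n : ℕ} (i : Fin (n + 2)) (x : stdSimplex ℝ (Fin (n + 1)))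
    (k : Fin (n + 1)) : faceInclusion n i x (i.succAbove k) = x k := by
  change stdSimplex.map i.succAbove x (i.succAbove k) = _
  simp [FunOnFinite.linearMap_apply_apply, Finset.filter_eq']

theorem faceInclusion_self {n : ℕ} (i : Fin (n + 2)) (x : stdSimplex ℝ (Fin (n + 1))) :
    faceInclusion n i x i = 0 := by
  change stdSimplex.map i.succAbove x i = _
  simp [FunOnFinite.linearMap_apply_apply]

theorem simplexCoord_succAbove {n : ℕ} (i : Fin (n + 2)) (x : stdSimplex ℝ (Fin (n + 1)))
    (k : Fin (n + 1)) : simplexCoord (i.succAbove k) (faceInclusion n i x) = simplexCoord k x :=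
  Subtype.ext (faceInclusion_succAbove i x k)

theorem simplexCoord_self {n : ℕ} (i : Fin (n + 2)) (x : stdSimplex ℝ (Fin (n + 1))) :
    simplexCoord i (faceInclusion n i x) = 0 :=
  Subtype.ext (faceInclusion_self i x)

variable {Y : Type u} [TopologicalSpace Y]

/-- The singular `0`-simplex at a point. -/
def pointSimplex (y : Y) : SingularSimplex Y 0 := ContinuousMap.const _ y

theorem eq_pointSimplex (τ : SingularSimplex Y 0) (x : stdSimplex ℝ (Fin 1)) :
    τ = pointSimplex (τ x) := by
  ext y
  rw [Subsingleton.elim y x]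
  rfl

/-- The singular `1`-simplex given by a path. -/
def pathSimplex {a b : Y} (γ : Path a b) : SingularSimplex Y 1 :=
  ⟨fun x => γ (simplexCoord 1 x), γ.continuous.comp (continuous_simplexCoord 1)⟩

theorem simplexCoord_zero_eq_symm (x : stdSimplex ℝ (Fin 2)) :
    simplexCoord 0 x = σ (simplexCoord 1 x) := by
  ext
  have := stdSimplex.add_eq_one x
  simp only [simplexCoord, coe_symm_eq]
  linarith

/-- The start of a singular `1`-simplex. -/
def simplexStart (τ : SingularSimplex Y 1) : Y := τ (faceInclusion 0 1 default)

/-- The end of a singular `1`-simplex. -/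
def simplexEnd (τ : SingularSimplex Y 1) : Y := τ (faceInclusion 0 0 default)

theorem comp_faceInclusion_one (τ : SingularSimplex Y 1) :
    τ.comp (faceInclusion 0 1) = pointSimplex (simplexStart τ) :=
  eq_pointSimplex _ _

theorem comp_faceInclusion_zero (τ : SingularSimplex Y 1) :
    τ.comp (faceInclusion 0 0) = pointSimplex (simplexEnd τ) :=
  eq_pointSimplex _ _

theorem simplexEnd_coord : simplexCoord 1 (faceInclusion 0 0 default) = 1 := by
  refine (simplexCoord_succAbove 0 default 0).trans (Subtype.ext ?_)
  exact stdSimplex.eq_one_of_unique (default : stdSimplex ℝ (Fin 1)) 0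

theorem simplexStart_pathSimplex {a b : Y} (γ : Path a b) : simplexStart (pathSimplex γ) = a := by
  have : simplexCoord 1 (faceInclusion 0 1 default) = 0 := simplexCoord_self _ _
  simp [simplexStart, pathSimplex, this]

theorem simplexEnd_pathSimplex {a b : Y} (γ : Path a b) : simplexEnd (pathSimplex γ) = b := by
  simp [simplexEnd, pathSimplex, simplexEnd_coord]

theorem exists_pathSimplex_eq (τ : SingularSimplex Y 1) :
    ∃ γ : Path (simplexStart τ) (simplexEnd τ), pathSimplex γ = τ := by
  let e : stdSimplex ℝ (Fin 2) ≃ₜ I := stdSimplexHomeomorphUnitInterval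
  have he : ∀ x, e x = simplexCoord 1 x := fun x => rfl
  have h0 : e.symm 0 = faceInclusion 0 1 default :=
    e.symm_apply_eq.2 (simplexCoord_self 1 default).symm
  have h1 : e.symm 1 = faceInclusion 0 0 default := by
    refine e.symm_apply_eq.2 ?_
    rw [he]
    exact (simplexEnd_coord).symm
  refine ⟨⟨⟨fun t => τ (e.symm t), by fun_prop⟩, congrArg τ h0, congrArg τ h1⟩, ?_⟩
  ext x
  change τ (e.symm (simplexCoord 1 x)) = τ x
  rw [← he, e.symm_apply_apply]

theorem singularBoundary_single_one (τ : SingularSimplex Y 1) (r : ℤ) :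
    singularBoundary Y 0 (Finsupp.single τ r) =
      Finsupp.single (pointSimplex (simplexEnd τ)) r -
        Finsupp.single (pointSimplex (simplexStart τ)) r := by
  simp [singularBoundary, Fin.sum_univ_succ, comp_faceInclusion_one, comp_faceInclusion_zero,
    sub_eq_add_neg]

/-- The class of a path in the singular `1`-chains modulo boundaries. -/
def pathClass {a b : Y} (γ : Path a b) :
    SingularChain Y 1 ⧸ LinearMap.range (singularBoundary Y 1) :=
  Submodule.Quotient.mk (Finsupp.single (pathSimplex γ) 1)

theorem pathClass_triangle {a b c : Y} {α : Path a b} {β : Path b c} {γ : Path a c}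
    (T : SingularSimplex Y 2) (h0 : T.comp (faceInclusion 1 0) = pathSimplex β)
    (h1 : T.comp (faceInclusion 1 1) = pathSimplex γ)
    (h2 : T.comp (faceInclusion 1 2) = pathSimplex α) :
    pathClass α + pathClass β = pathClass γ := by
  rw [← sub_eq_zero]
  refine (Submodule.Quotient.mk_eq_zero _).2 ⟨Finsupp.single T 1, ?_⟩
  simp [singularBoundary, Fin.sum_univ_succ, h0, h1, h2]
  abel

theorem pathClass_trans {a b c : Y} (α : Path a b) (β : Path b c) :
    pathClass (α.trans β) = pathClass α + pathClass β := by
  symm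
  -- The parameter takes the values 0, 1/2, 1 at the three vertices, so the edges trace `α`, `β` and
  -- their concatenation.
  refine pathClass_triangle ⟨fun x => (α.trans β).extend
    ((simplexCoord 1 x : ℝ) / 2 + simplexCoord 2 x), (α.trans β).continuous_extend.comp ?_⟩ ?_ ?_ ?_
  · have h1 := continuous_subtype_val.comp (continuous_simplexCoord (n := 2) 1)
    have h2 := continuous_subtype_val.comp (continuous_simplexCoord (n := 2) 2)
    exact (h1.div_const 2).add h2
  all_goals
    ext x
    have hx := congrArg Subtype.val (simplexCoord_zero_eq_symm x)
    rw [coe_symm_eq] at hx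
    have hx0 := (simplexCoord 1 x).2.1
    have hx1 := (simplexCoord 1 x).2.2
  · have e1 : simplexCoord 1 (faceInclusion 1 0 x) = simplexCoord 0 x :=
      simplexCoord_succAbove 0 x 0
    have e2 : simplexCoord 2 (faceInclusion 1 0 x) = simplexCoord 1 x :=
      simplexCoord_succAbove 0 x 1
    change (α.trans β).extend _ = β (simplexCoord 1 x)
    rw [e1, e2, hx, Path.extend_trans_of_half_le _ _ (by linarith), ← Path.extend_extends']
    congr 1
    ring
  · have e1 : simplexCoord 1 (faceInclusion 1 1 x) = 0 := simplexCoord_self 1 x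
    have e2 : simplexCoord 2 (faceInclusion 1 1 x) = simplexCoord 1 x :=
      simplexCoord_succAbove 1 x 1
    change (α.trans β).extend _ = (α.trans β) (simplexCoord 1 x)
    rw [e1, e2, ← Path.extend_extends']
    simp
  · have e1 : simplexCoord 1 (faceInclusion 1 2 x) = simplexCoord 1 x :=
      simplexCoord_succAbove 2 x 1
    have e2 : simplexCoord 2 (faceInclusion 1 2 x) = 0 := simplexCoord_self 2 x
    change (α.trans β).extend _ = α (simplexCoord 1 x)
    rw [e1, e2, Path.extend_trans_of_le_half _ _ (by simp; linarith), ← Path.extend_extends']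
    congr 1
    simp
    ring

theorem pathClass_refl (a : Y) : pathClass (Path.refl a) = 0 := by
  have := pathClass_trans (Path.refl a) (Path.refl a)
  rw [Path.refl_trans_refl] at this
  simpa using this

/-- The diagonal `δ` cuts the square of the homotopy into two triangles. The other edges are `α`,
`β` and constant paths, whose class is zero. -/
theorem pathClass_eq_of_homotopic {a b : Y} {α β : Path a b} (h : α.Homotopic β) :
    pathClass α = pathClass β := by
  obtain ⟨H⟩ := h
  let δ : Path a b := ⟨⟨fun t => H (t, t), by fun_prop⟩, by simp, by simp⟩
  have h1 : pathClass α + pathClass (Path.refl b) = pathClass δ := by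
    refine pathClass_triangle ⟨fun x => H (simplexCoord 2 x, σ (simplexCoord 0 x)),
      H.continuous.comp ((continuous_simplexCoord 2).prodMk
        (continuous_symm.comp (continuous_simplexCoord 0)))⟩ ?_ ?_ ?_
    all_goals ext x
    · change H (simplexCoord 2 (faceInclusion 1 0 x), σ (simplexCoord 0 (faceInclusion 1 0 x))) = b
      rw [simplexCoord_self, symm_zero, H.target]
    · have e2 : simplexCoord 2 (faceInclusion 1 1 x) = simplexCoord 1 x :=
        simplexCoord_succAbove 1 x 1
      have e0 : simplexCoord 0 (faceInclusion 1 1 x) = simplexCoord 0 x :=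
        simplexCoord_succAbove 1 x 0
      change H (simplexCoord 2 (faceInclusion 1 1 x), σ (simplexCoord 0 (faceInclusion 1 1 x))) =
        H (simplexCoord 1 x, simplexCoord 1 x)
      rw [e2, e0, simplexCoord_zero_eq_symm, symm_symm]
    · have e0 : simplexCoord 0 (faceInclusion 1 2 x) = simplexCoord 0 x :=
        simplexCoord_succAbove 2 x 0
      change H (simplexCoord 2 (faceInclusion 1 2 x), σ (simplexCoord 0 (faceInclusion 1 2 x))) =
        α (simplexCoord 1 x)
      rw [simplexCoord_self, e0, simplexCoord_zero_eq_symm, symm_symm, H.apply_zero]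
      rfl
  have h2 : pathClass (Path.refl a) + pathClass β = pathClass δ := by
    refine pathClass_triangle ⟨fun x => H (σ (simplexCoord 0 x), simplexCoord 2 x),
      H.continuous.comp ((continuous_symm.comp (continuous_simplexCoord 0)).prodMk
        (continuous_simplexCoord 2))⟩ ?_ ?_ ?_
    all_goals ext x
    · have e2 : simplexCoord 2 (faceInclusion 1 0 x) = simplexCoord 1 x :=
        simplexCoord_succAbove 0 x 1
      change H (σ (simplexCoord 0 (faceInclusion 1 0 x)), simplexCoord 2 (faceInclusion 1 0 x)) =
        β (simplexCoord 1 x)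
      rw [simplexCoord_self, e2, symm_zero, H.apply_one]
      rfl
    · have e2 : simplexCoord 2 (faceInclusion 1 1 x) = simplexCoord 1 x :=
        simplexCoord_succAbove 1 x 1
      have e0 : simplexCoord 0 (faceInclusion 1 1 x) = simplexCoord 0 x :=
        simplexCoord_succAbove 1 x 0
      change H (σ (simplexCoord 0 (faceInclusion 1 1 x)), simplexCoord 2 (faceInclusion 1 1 x)) =
        H (simplexCoord 1 x, simplexCoord 1 x)
      rw [e2, e0, simplexCoord_zero_eq_symm, symm_symm]
    · change H (σ (simplexCoord 0 (faceInclusion 1 2 x)), simplexCoord 2 (faceInclusion 1 2 x)) = a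
      rw [simplexCoord_self, H.source]
  rw [pathClass_refl] at h1 h2
  rw [← add_zero (pathClass α), h1, ← h2, zero_add]

end Chains

end

/-! ### Orders of modules -/

section Order

instance : IsNoetherianRing ℤ[T;T⁻¹] :=
  IsLocalization.isNoetherianRing (Submonoid.powers (Polynomial.X : Polynomial ℤ)) _ inferInstance

instance : UniqueFactorizationMonoid ℤ[T;T⁻¹] :=
  UniqueFactorizationMonoid.of_isLocalization (Submonoid.powers (Polynomial.X : Polynomial ℤ)) _

variable {S : Type v} [CommRing S] {M : Type u} [AddCommGroup M] [Module S M]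

variable (S M) in
-- The relation determinants generate a finitely generated ideal, and their common divisors are
-- those of its finitely many generators.
theorem exists_isOrder [IsNoetherianRing S] [UniqueFactorizationMonoid S] [Module.Finite S M] :
    ∃ Δ : S, IsOrder S M Δ := by
  obtain ⟨n, x, hx⟩ := Module.Finite.exists_fin (R := S) (M := M)
  let D : Set S := {s | ∃ A : Matrix (Fin n) (Fin n) S, (∀ i, ∑ j, A i j • x j = 0) ∧ A.det = s}
  obtain ⟨F, hF⟩ := (isNoetherianRing_iff_ideal_fg S).1 inferInstance (Ideal.span D)
  obtain ⟨_⟩ := (inferInstance : Nonempty (NormalizedGCDMonoid S))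
  refine ⟨F.gcd id, n, x, hx, fun d => ?_⟩
  have key : ∀ E : Set S, (∀ s ∈ E, d ∣ s) ↔ Ideal.span E ≤ Ideal.span {d} := fun E => by
    rw [Ideal.span_le]
    exact forall₂_congr fun s _ => Ideal.mem_span_singleton.symm
  rw [Finset.dvd_gcd_iff]
  refine ((key F).trans ?_).trans ((key D).symm.trans ?_)
  · rw [← hF]
  · exact ⟨fun h A hA => h _ ⟨A, hA, rfl⟩, by rintro h _ ⟨A, hA, rfl⟩; exact h A hA⟩

variable [IsDomain S]

/-- If all generators are torsion, their annihilators form a diagonal relation matrix with nonzero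
determinant. Conversely, multiplying by the adjugate shows that every relation determinant kills the
whole module. -/
theorem isOrder_eq_zero_iff {Δ : S} (h : IsOrder S M Δ) :
    Δ = 0 ↔ ∃ z : M, ∀ s : S, s • z = 0 → s = 0 := by
  obtain ⟨n, x, hx, hΔ⟩ := h
  rw [← zero_dvd_iff, hΔ]
  constructor
  · intro h
    by_contra! hz
    choose s hs hs0 using fun j => hz (x j)
    refine (Finset.prod_ne_zero_iff (s := Finset.univ) (f := s)).2 (fun j _ => hs0 j) ?_
    rw [← Matrix.det_diagonal]
    refine zero_dvd_iff.1 (h (Matrix.diagonal s) fun i => ?_)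
    simp [Matrix.diagonal_apply, ite_smul, hs]
  · rintro ⟨z, hz⟩ A hA
    rw [zero_dvd_iff]
    refine hz _ ?_
    have hdet : ∀ j, A.det • x j = 0 := fun j => by
      have h1 : ∑ i, A.adjugate j i • ∑ k, A i k • x k = 0 := by simp [hA]
      simp only [Finset.smul_sum, smul_smul] at h1
      rw [Finset.sum_comm] at h1
      simp only [← Finset.sum_smul, ← Matrix.mul_apply, Matrix.adjugate_mul] at h1
      simpa [Matrix.one_apply, ite_smul] using h1
    have hker : Submodule.span S (Set.range x) ≤ LinearMap.ker (LinearMap.lsmul S M A.det) :=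
      Submodule.span_le.2 (Set.range_subset_iff.2 hdet)
    exact hker (hx ▸ Submodule.mem_top)

open scoped nonZeroDivisors in
-- A non-torsion element survives over the fraction field, where a functional detects it. Clearing
-- denominators on finitely many generators makes that functional `S`-valued.
theorem exists_functional_ne_zero [Module.Finite S M] {z : M} (hz : ∀ s : S, s • z = 0 → s = 0) :
    ∃ l : M →ₗ[S] S, l z ≠ 0 := by
  let K := FractionRing S
  let m : M →ₗ[S] LocalizedModule S⁰ M := LocalizedModule.mkLinearMap S⁰ M
  have hmz : m z ≠ 0 := by
    intro h
    obtain ⟨s, hs⟩ := (IsLocalizedModule.eq_zero_iff S⁰ m).1 h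
    exact nonZeroDivisors.coe_ne_zero s (hz s hs)
  obtain ⟨f, hf⟩ : ∃ f : Module.Dual K (LocalizedModule S⁰ M), f (m z) ≠ 0 := by
    by_contra! h
    exact hmz ((Module.forall_dual_apply_eq_zero_iff K _).1 h)
  obtain ⟨F, hF⟩ := (Module.Finite.fg_top : (⊤ : Submodule S M).FG)
  obtain ⟨b, hb⟩ := IsLocalization.exist_integer_multiples S⁰ F fun y => f (m y)
  let g : M →ₗ[S] K := (b : S) • (f.restrictScalars S).comp m
  have hg : ∀ y, g y ∈ LinearMap.range (Algebra.linearMap S K) := by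
    intro y
    have hy : y ∈ Submodule.span S (F : Set M) := hF ▸ Submodule.mem_top
    have : Submodule.span S (F : Set M) ≤ (LinearMap.range (Algebra.linearMap S K)).comap g :=
      Submodule.span_le.2 fun y hy => hb y hy
    exact this hy
  let e := LinearEquiv.ofInjective (Algebra.linearMap S K) (IsFractionRing.injective S K)
  refine ⟨e.symm.toLinearMap.comp (g.codRestrict _ hg), fun h => ?_⟩
  have h1 : g z = 0 := by
    have := (LinearEquiv.map_eq_zero_iff e.symm).1 h
    exact congrArg Subtype.val this
  have h2 : (b : S) • f (m z) = 0 := h1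
  rw [Algebra.smul_def, mul_eq_zero] at h2
  refine hf (h2.resolve_left fun h => nonZeroDivisors.coe_ne_zero b ?_)
  exact (map_eq_zero_iff _ (IsFractionRing.injective S K)).1 h

end Order

section

open LaurentPolynomial

/-! ### The group ring as the dual of the coefficient module -/

section GroupRing

variable {G : Type v} [Group G]

/-- Right multiplication by an element of `G × ℤ` on `ℤ[t, t⁻¹]^G`. -/
def rightTranslate (γ : G × Multiplicative ℤ) : (G → ℤ[T;T⁻¹]) →ₗ[ℤ[T;T⁻¹]] (G → ℤ[T;T⁻¹]) :=
  (T γ.2.toAdd : ℤ[T;T⁻¹]) • LinearMap.funLeft ℤ[T;T⁻¹] ℤ[T;T⁻¹] fun h => h * γ.1⁻¹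

theorem rightTranslate_apply (γ : G × Multiplicative ℤ) (v : G → ℤ[T;T⁻¹]) (h : G) :
    rightTranslate γ v h = T γ.2.toAdd * v (h * γ.1⁻¹) := rfl

theorem rightTranslate_mul (γ δ : G × Multiplicative ℤ) (v : G → ℤ[T;T⁻¹]) :
    rightTranslate (γ * δ) v = rightTranslate δ (rightTranslate γ v) := by
  ext1 h
  simp only [rightTranslate_apply, Prod.snd_mul, Prod.fst_mul, toAdd_mul, T_add, mul_inv_rev]
  rw [mul_comm (T γ.2.toAdd), mul_assoc, mul_assoc]

theorem rightTranslate_one (v : G → ℤ[T;T⁻¹]) : rightTranslate 1 v = v := by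
  ext1 h
  simp [rightTranslate_apply]

theorem single_eq_smul_T (n c : ℤ) : (AddMonoidAlgebra.single n c : ℤ[T;T⁻¹]) = c • T n := by
  rw [T, AddMonoidAlgebra.smul_single, smul_eq_mul, mul_one]

theorem coeff_T (n : ℤ) : (T n : ℤ[T;T⁻¹]).coeff = Finsupp.single n 1 := rfl

/-- The pairing of `ℤ[t, t⁻¹]^G = ℤ[G × ℤ]` with `ℤ[G × ℤ]` that maps `(v, a)` to the coefficient
at the neutral element of `G` of the product `v a`. -/
def groupRingPairing : MonoidAlgebra ℤ (G × Multiplicative ℤ) →+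
    ((G → ℤ[T;T⁻¹]) →ₗ[ℤ[T;T⁻¹]] ℤ[T;T⁻¹]) :=
  (Finsupp.liftAddHom fun γ : G × Multiplicative ℤ =>
    (AddMonoidHom.flip (smulAddHom ℤ ((G → ℤ[T;T⁻¹]) →ₗ[ℤ[T;T⁻¹]] ℤ[T;T⁻¹])))
      ((T γ.2.toAdd : ℤ[T;T⁻¹]) • LinearMap.proj γ.1⁻¹)).comp
    MonoidAlgebra.coeffAddEquiv.toAddMonoidHom

theorem groupRingPairing_single (γ : G × Multiplicative ℤ) (c : ℤ) (v : G → ℤ[T;T⁻¹]) :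
    groupRingPairing (MonoidAlgebra.single γ c) v = c • (T γ.2.toAdd * v γ.1⁻¹) := by
  simp [groupRingPairing, MonoidAlgebra.coeffAddEquiv]

/-- This adjunction turns the derivation rule in the group ring into the cocycle rule for
functionals on the coefficients. -/
theorem groupRingPairing_single_mul (γ : G × Multiplicative ℤ)
    (a : MonoidAlgebra ℤ (G × Multiplicative ℤ)) (v : G → ℤ[T;T⁻¹]) :
    groupRingPairing (MonoidAlgebra.single γ 1 * a) v =
      groupRingPairing a (rightTranslate γ v) := by
  induction a using MonoidAlgebra.induction_linear with
  | zero => simp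
  | add a b ha hb =>
    rw [mul_add, map_add, map_add, LinearMap.add_apply, LinearMap.add_apply, ha, hb]
  | single δ c =>
    rw [MonoidAlgebra.single_mul_single, groupRingPairing_single, groupRingPairing_single,
      rightTranslate_apply]
    simp only [Prod.snd_mul, Prod.fst_mul, toAdd_mul, T_add, mul_inv_rev, one_mul]
    rw [mul_comm (T γ.2.toAdd : ℤ[T;T⁻¹]), mul_assoc]

variable [DecidableEq G]

theorem coeff_groupRingPairing (a : MonoidAlgebra ℤ (G × Multiplicative ℤ)) (h : G) (n : ℤ) :
    (groupRingPairing a (Pi.single h⁻¹ 1)).coeff n = a.coeff (h, Multiplicative.ofAdd n) := by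
  induction a using MonoidAlgebra.induction_linear with
  | zero => simp
  | add a b ha hb => simp [ha, hb]
  | single γ c =>
    obtain ⟨k, m⟩ := γ
    rw [groupRingPairing_single]
    rw [MonoidAlgebra.coeff_single, Finsupp.single_apply]
    by_cases hk : k = h
    · subst hk
      rw [Pi.single_eq_same, mul_one, ← single_eq_smul_T, AddMonoidAlgebra.coeff_single,
        Finsupp.single_apply]
      simp only [Prod.mk.injEq, true_and]
      rfl
    · simp [hk]

theorem groupRingPairing_injective : Function.Injective (groupRingPairing (G := G)) := by
  intro a b hab
  ext γ
  have := coeff_groupRingPairing a γ.1 γ.2.toAdd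
  rw [hab, coeff_groupRingPairing b] at this
  exact this.symm

variable [Fintype G]

theorem coeffAction_eq_rightTranslate {X : Type u} [TopologicalSpace X] {x₀ : X}
    (φ : Pi1 X x₀ →* Multiplicative ℤ) (f : Pi1 X x₀ →* G) (g : Pi1 X x₀) (v : G → ℤ[T;T⁻¹]) :
    coeffAction φ ((regularRep G).comp f) g v = rightTranslate (f.prod φ g) v := by
  ext1 h
  have : ∀ k : G, (k * f g = h) ↔ k = h * (f g)⁻¹ := fun k => eq_mul_inv_iff_mul_eq.symm
  simp [coeffAction, rightTranslate_apply, Matrix.vecMul, dotProduct, regularRep,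
    MonoidHom.toHomUnits, apply_ite, this]

theorem groupRingPairing_surjective : Function.Surjective (groupRingPairing (G := G)) := by
  intro l
  have key : ∀ (x : ℤ[T;T⁻¹]) (h : G), ∃ a : MonoidAlgebra ℤ (G × Multiplicative ℤ),
      ∀ v, groupRingPairing a v = x * v h := by
    intro x h
    induction x using AddMonoidAlgebra.induction_linear with
    | zero => exact ⟨0, by simp⟩
    | add x y hx hy =>
      obtain ⟨a, ha⟩ := hx
      obtain ⟨b, hb⟩ := hy
      exact ⟨a + b, fun v => by simp [ha, hb, add_mul]⟩
    | single n c =>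
      refine ⟨MonoidAlgebra.single (h⁻¹, Multiplicative.ofAdd n) c, fun v => ?_⟩
      rw [groupRingPairing_single]
      rw [single_eq_smul_T, smul_mul_assoc]
      simp
  choose a ha using fun h => key (l (Pi.single h 1)) h
  refine ⟨∑ h, a h, LinearMap.pi_ext' fun k => LinearMap.ext_ring ?_⟩
  simp [ha, Pi.single_apply]

/-- A derivation `d` along `F` which vanishes on the kernel of `F` is the coboundary of an additive
map on `ℤ[t, t⁻¹]^G`: on the basis `G × ℤ` choose a representative of each coset of the range of
`F`, let the map vanish there, and extend it to the coset by `d`. -/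
theorem exists_primitive_of_derivation {π : Type u} [Group π] (F : π →* G × Multiplicative ℤ)
    (d : π → MonoidAlgebra ℤ (G × Multiplicative ℤ))
    (hd : ∀ g h, d (g * h) = d g + MonoidAlgebra.single (F g) 1 * d h)
    (hker : ∀ g, F g = 1 → d g = 0) :
    ∃ D : (G → ℤ[T;T⁻¹]) →+ ℤ[T;T⁻¹],
      ∀ g v, D (rightTranslate (F g) v) = D v + groupRingPairing (d g) v := by
  -- Thus `d` descends to the range of `F`, which permutes the basis `e` freely.
  have hFd : ∀ g h, F g = F h → d g = d h := by
    intro g h hgh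
    have := hd g (g⁻¹ * h)
    rw [hker (g⁻¹ * h) (by simp [hgh]), mul_zero, add_zero, mul_inv_cancel_left] at this
    exact this.symm
  let c : G × Multiplicative ℤ → G × Multiplicative ℤ :=
    fun γ => (QuotientGroup.mk γ : _ ⧸ F.range).out
  have hc : ∀ γ, ∃ g, γ = c γ * F g := by
    intro γ
    have : (QuotientGroup.mk (c γ) : _ ⧸ F.range) = QuotientGroup.mk γ := Quotient.out_eq' _
    obtain ⟨g, hg⟩ := QuotientGroup.eq.1 this
    exact ⟨g, by rw [hg, mul_inv_cancel_left]⟩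
  choose r hr using hc
  have hcF : ∀ γ g, c (γ * F g) = c γ := by
    intro γ g
    change Quotient.out _ = Quotient.out _
    congr 1
    exact QuotientGroup.eq.2 ⟨g⁻¹, by simp⟩
  let e : G × Multiplicative ℤ → G → ℤ[T;T⁻¹] := fun γ => rightTranslate γ (Pi.single 1 1)
  let δ : G × Multiplicative ℤ → ℤ[T;T⁻¹] := fun γ => groupRingPairing (d (r γ)) (e (c γ))
  have hδ : ∀ γ g, δ (γ * F g) = δ γ + groupRingPairing (d g) (e γ) := by
    intro γ g
    have h1 : d (r (γ * F g)) = d (r γ * g) := hFd _ _ <| by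
      have := hr (γ * F g)
      rw [hcF] at this
      nth_rewrite 1 [hr γ] at this
      rw [mul_assoc, mul_left_cancel_iff] at this
      rw [← this, map_mul]
    have h2 : e γ = rightTranslate (F (r γ)) (e (c γ)) := by
      rw [← rightTranslate_mul, ← hr]
    simp only [δ]
    rw [h1, hcF, hd, map_add, LinearMap.add_apply, groupRingPairing_single_mul, h2]
  have he : ∀ (h : G) (n : ℤ), e (h, Multiplicative.ofAdd n) = Pi.single h (T n) := by
    intro h n
    ext1 k
    simp only [e, rightTranslate_apply, Pi.single_apply, mul_inv_eq_one]
    simp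
  -- The extension of `δ` from the ℤ-basis `e` is only additive: `δ` need not be compatible with
  -- multiplication by `t`.
  let D : (G → ℤ[T;T⁻¹]) →+ ℤ[T;T⁻¹] := ∑ h : G,
    ((Finsupp.liftAddHom fun n : ℤ => (AddMonoidHom.flip (smulAddHom ℤ ℤ[T;T⁻¹]))
      (δ (h, Multiplicative.ofAdd n))).comp AddMonoidAlgebra.coeffAddEquiv.toAddMonoidHom).comp
      (Pi.evalAddMonoidHom (fun _ : G => ℤ[T;T⁻¹]) h)
  have hDe : ∀ γ, D (e γ) = δ γ := by
    rintro ⟨h, n⟩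
    obtain ⟨n, rfl⟩ := Multiplicative.ofAdd.surjective n
    rw [he]
    simp only [D, AddMonoidHom.finsetSum_apply, AddMonoidHom.comp_apply]
    rw [Finset.sum_eq_single h]
    · simp [coeff_T, AddMonoidAlgebra.coeffAddEquiv]
    · intro k _ hk
      simp [hk]
    · simp
  refine ⟨D, fun g v => ?_⟩
  have hv : v ∈ AddSubgroup.closure (Set.range e) := by
    have : v = ∑ h, Pi.single h (v h) := (Finset.univ_sum_single v).symm
    rw [this]
    refine sum_mem fun h _ => ?_
    induction v h using AddMonoidAlgebra.induction_linear with
    | zero => simp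
    | add x y hx hy => rw [Pi.single_add]; exact add_mem hx hy
    | single n c =>
      rw [single_eq_smul_T, Pi.single_zsmul, ← he]
      exact zsmul_mem (AddSubgroup.subset_closure (Set.mem_range_self _)) _
  induction hv using AddSubgroup.closure_induction with
  | zero => simp
  | add x y _ _ hx hy => simp only [map_add, hx, hy]; abel
  | neg x _ hx => simp only [map_neg, hx]; abel
  | mem x hx =>
    obtain ⟨γ, rfl⟩ := hx
    have : rightTranslate (F g) (e γ) = e (γ * F g) := (rightTranslate_mul _ _ _).symm
    rw [this, hDe, hDe, hδ]

end GroupRing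

/-! ### Lifts to the semidirect product and derivations -/

/-- Multiplication in the semidirect product makes the left component of a lift a derivation. The
elements of the image over the identity are those coming from the kernel of `F`. -/
theorem exists_isNontrivialLift_iff {π : Type u} [Group π] {Γ : Type v} [Group Γ] (F : π →* Γ) :
    (∃ l : π →* GroupRingSemidirect Γ, IsNontrivialLift F l) ↔
      ∃ d : π → MonoidAlgebra ℤ Γ,
        (∀ g h, d (g * h) = d g + MonoidAlgebra.single (F g) 1 * d h) ∧ ∃ k, F k = 1 ∧ d k ≠ 0 := by
  constructor
  · rintro ⟨l, hl, hne⟩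
    have hF : ∀ g, (l g).right = F g := fun g => DFunLike.congr_fun hl g
    refine ⟨fun g => (l g).left.toAdd, fun g h => ?_, ?_⟩
    · dsimp only
      rw [map_mul, SemidirectProduct.mul_left, hF]
      rfl
    · by_contra! hk
      refine hne (Set.eq_singleton_iff_unique_mem.2 ⟨⟨l.range.one_mem, rfl⟩, ?_⟩)
      rintro _ ⟨⟨k, rfl⟩, h1⟩
      exact SemidirectProduct.ext (hk k ((hF k).symm.trans h1)) h1
  · rintro ⟨d, hd, k, hk, hdk⟩
    refine ⟨MonoidHom.mk' (fun g => ⟨Multiplicative.ofAdd (d g), F g⟩) fun g h =>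
      SemidirectProduct.ext (congrArg Multiplicative.ofAdd (hd g h)) (map_mul F g h), ?_,
      fun h => ?_⟩
    · ext g
      rfl
    · have h1 := Set.ext_iff.1 h ⟨Multiplicative.ofAdd (d k), F k⟩
      have h2 := h1.1 ⟨⟨k, rfl⟩, hk⟩
      exact hdk (congrArg (fun x : GroupRingSemidirect Γ => x.left.toAdd) h2)

end

/-! ### Linear maps out of the twisted chains -/

section TwistedChain

variable {X : Type u} [TopologicalSpace X] {x₀ : X} {R : Type v} [CommRing R]
  {ι : Type w} [Fintype ι] [DecidableEq ι]
  (φ : Pi1 X x₀ →* Multiplicative ℤ) (ρ : Pi1 X x₀ →* GL ι R) (n : ℕ)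

/-- The class of `m ⊗ c` in the twisted chains. -/
def chainClass : SingularChain (UniversalCover x₀) n →ₗ[ℤ]
    ((ι → R[T;T⁻¹]) →ₗ[R[T;T⁻¹]] TwistedChain φ ρ n) where
  toFun c := (tensorRelations φ ρ n).mkQ.comp
    ((TensorProduct.AlgebraTensorModule.mk ℤ R[T;T⁻¹] (ι → R[T;T⁻¹]) _).flip c)
  map_add' c c' := by ext; simp
  map_smul' a c := by ext; simp

variable {φ ρ n}

theorem chainClass_apply (c : SingularChain (UniversalCover x₀) n) (m : ι → R[T;T⁻¹]) :
    chainClass φ ρ n c m = (tensorRelations φ ρ n).mkQ (m ⊗ₜ[ℤ] c) := rfl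

theorem chainClass_coeffAction (g : Pi1 X x₀) (c : SingularChain (UniversalCover x₀) n)
    (m : ι → R[T;T⁻¹]) :
    chainClass φ ρ n c (coeffAction φ ρ g m) =
      chainClass φ ρ n (chainAction (UniversalCover x₀) n g c) m :=
  (Submodule.Quotient.eq _).2 (Submodule.subset_span ⟨g, m, c, rfl⟩)

theorem twistedBoundary_chainClass (c : SingularChain (UniversalCover x₀) (n + 1))
    (m : ι → R[T;T⁻¹]) :
    twistedBoundary φ ρ n (chainClass φ ρ (n + 1) c m) =
      chainClass φ ρ n (singularBoundary (UniversalCover x₀) n c) m := rfl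

theorem TwistedChain.induction {p : TwistedChain φ ρ n → Prop} (zero : p 0)
    (add : ∀ y z, p y → p z → p (y + z))
    (simplex : ∀ τ m, p (chainClass φ ρ n (Finsupp.single τ 1) m)) (y : TwistedChain φ ρ n) :
    p y := by
  obtain ⟨y, rfl⟩ := Submodule.mkQ_surjective _ y
  induction y using TensorProduct.induction_on with
  | zero => rwa [map_zero]
  | add y z hy hz => rw [map_add]; exact add _ _ hy hz
  | tmul m c =>
    rw [← chainClass_apply]
    induction c using Finsupp.induction_linear with
    | zero => rwa [map_zero]
    | add c c' hc hc' => rw [map_add]; exact add _ _ hc hc'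
    | single τ a =>
      have : Finsupp.single τ a = a • Finsupp.single τ (1 : ℤ) := by simp
      rw [this, map_smul, LinearMap.smul_apply, ← map_zsmul]
      exact simplex τ (a • m)

/-- The linear map on the twisted chains that is induced by a map on singular chains. -/
def chainLift {P : Type*} [AddCommGroup P] [Module R[T;T⁻¹] P]
    (B : SingularChain (UniversalCover x₀) n →ₗ[ℤ] ((ι → R[T;T⁻¹]) →ₗ[R[T;T⁻¹]] P))
    (hB : ∀ g τ m, B (Finsupp.single τ 1) (coeffAction φ ρ g m) =
      B (chainAction (UniversalCover x₀) n g (Finsupp.single τ 1)) m) :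
    TwistedChain φ ρ n →ₗ[R[T;T⁻¹]] P :=
  (tensorRelations φ ρ n).liftQ (TensorProduct.AlgebraTensorModule.lift
    { toFun := fun m =>
        { toFun := fun c => B c m
          map_add' := fun c c' => by simp
          map_smul' := fun a c => by simp }
      map_add' := fun m m' => by ext; simp
      map_smul' := fun a m => by ext; simp }) <| by
    refine Submodule.span_le.2 ?_
    rintro _ ⟨g, m, c, rfl⟩
    have : B c (coeffAction φ ρ g m) = B (chainAction (UniversalCover x₀) n g c) m := by
      induction c using Finsupp.induction_linear with
      | zero => simp
      | add c c' hc hc' => simp only [map_add, LinearMap.add_apply, hc, hc']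
      | single τ a =>
        have : Finsupp.single τ a = a • Finsupp.single τ (1 : ℤ) := by simp
        rw [this, map_smul, map_smul, map_smul, LinearMap.smul_apply, LinearMap.smul_apply, hB]
    simpa [sub_eq_zero] using this

theorem chainLift_chainClass {P : Type*} [AddCommGroup P] [Module R[T;T⁻¹] P]
    (B : SingularChain (UniversalCover x₀) n →ₗ[ℤ] ((ι → R[T;T⁻¹]) →ₗ[R[T;T⁻¹]] P))
    (hB : ∀ g τ m, B (Finsupp.single τ 1) (coeffAction φ ρ g m) =
      B (chainAction (UniversalCover x₀) n g (Finsupp.single τ 1)) m)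
    (c : SingularChain (UniversalCover x₀) n) (m : ι → R[T;T⁻¹]) :
    chainLift B hB (chainClass φ ρ n c m) = B c m := rfl

end TwistedChain

/-! ### Equivariance of singular chains and a section of the fibres -/

section Equivariance

theorem chainAction_single {Γ : Type v} [Group Γ] {Y : Type u} [TopologicalSpace Y]
    [MulAction Γ Y] [ContinuousConstSMul Γ Y] {n : ℕ} (g : Γ) (τ : SingularSimplex Y n) (a : ℤ) :
    chainAction Y n g (Finsupp.single τ a) =
      Finsupp.single ((⟨fun y => g • y, continuous_const_smul g⟩ : C(Y, Y)).comp τ) a :=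
  Finsupp.mapDomain_single

theorem singularBoundary_singularBoundary {Y : Type u} [TopologicalSpace Y]
    (c : SingularChain Y 2) : singularBoundary Y 0 (singularBoundary Y 1 c) = 0 := by
  have face : ∀ (i j : Fin 3) (k l : Fin 2), i.succAbove ∘ k.succAbove = j.succAbove ∘ l.succAbove →
      (faceInclusion 1 i).comp (faceInclusion 0 k) =
        (faceInclusion 1 j).comp (faceInclusion 0 l) := by
    intro i j k l h
    ext1 x
    change stdSimplex.map i.succAbove (stdSimplex.map k.succAbove x) =
      stdSimplex.map j.succAbove (stdSimplex.map l.succAbove x)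
    rw [stdSimplex.map_comp_apply, stdSimplex.map_comp_apply, h]
  induction c using Finsupp.induction_linear with
  | zero => simp
  | add c c' hc hc' => simp only [map_add, hc, hc', add_zero]
  | single τ a =>
    simp only [singularBoundary, Fin.sum_univ_succ, Finsupp.lmapDomain_apply, map_add, map_smul,
      LinearMap.add_apply, LinearMap.smul_apply, Finsupp.mapDomain_single, Fin.sum_univ_zero,
      ContinuousMap.comp_assoc, LinearMap.zero_apply, map_zero]
    simp [face 0 1 0 0 (by decide), face 0 2 1 0 (by decide),
      face 1 2 1 1 (by decide)]
    abel

/-- After a choice of one point in each fibre, `r p` is the unique deck transformation carrying the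
chosen point to `p`. No continuity is needed. -/
theorem exists_equivariant {X : Type u} [TopologicalSpace X] (x₀ : X) :
    ∃ r : UniversalCover x₀ → Pi1 X x₀, ∀ g p, r (g • p) = g * r p := by
  have h : ∀ p : UniversalCover x₀, ∃ g : Pi1 X x₀,
      g • (Function.invFun Sigma.fst p.1 : UniversalCover x₀) = p := fun p =>
    exists_smul_eq (Function.invFun_eq ⟨p, rfl⟩).symm
  choose r hr using h
  refine ⟨r, fun g p => ?_⟩
  have h1 : r (g • p) • (Function.invFun Sigma.fst p.1 : UniversalCover x₀) = (g * r p) •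
      (Function.invFun Sigma.fst p.1 : UniversalCover x₀) := by
    rw [mul_smul, hr p]
    exact hr (g • p)
  have h2 := eq_one_of_smul_eq (g := (g * r p)⁻¹ * r (g • p)) (by rw [mul_smul, h1, inv_smul_smul])
  exact (inv_mul_eq_one.1 h2).symm

theorem chainAction_pointSimplex {Γ : Type v} [Group Γ] {Y : Type u} [TopologicalSpace Y]
    [MulAction Γ Y] [ContinuousConstSMul Γ Y] (g : Γ) (y : Y) (a : ℤ) :
    chainAction Y 0 g (Finsupp.single (pointSimplex y) a) =
      Finsupp.single (pointSimplex (g • y)) a :=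
  chainAction_single g _ a

theorem chainAction_pathSimplex {Γ : Type v} [Group Γ] {Y : Type u} [TopologicalSpace Y]
    [MulAction Γ Y] [ContinuousConstSMul Γ Y] (g : Γ) {p q : Y} (γ : Path p q) (a : ℤ) :
    chainAction Y 1 g (Finsupp.single (pathSimplex γ) a) =
      Finsupp.single (pathSimplex (γ.map (continuous_const_smul g))) a :=
  chainAction_single g _ a

theorem singularBoundary_pathSimplex {Y : Type u} [TopologicalSpace Y] {p q : Y} (γ : Path p q)
    (a : ℤ) : singularBoundary Y 0 (Finsupp.single (pathSimplex γ) a) =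
      Finsupp.single (pointSimplex q) a - Finsupp.single (pointSimplex p) a := by
  rw [singularBoundary_single_one, simplexStart_pathSimplex, simplexEnd_pathSimplex]

end Equivariance

/-! ### From lifts to homology classes that are not torsion -/

section OfDerivation

variable {X : Type u} [TopologicalSpace X] {x₀ : X} {G : Type v} [Group G] [Fintype G]
  [DecidableEq G] {φ : Pi1 X x₀ →* Multiplicative ℤ} {f : Pi1 X x₀ →* G}

/-- The witness is the class of `m ⊗ γ` for a path `γ` from `p` to `k • p`. It is not torsion
because a linear functional on homology is nonzero there. -/
theorem exists_not_torsion_of_derivation [PathConnectedSpace X]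
    (d : Pi1 X x₀ → MonoidAlgebra ℤ (G × Multiplicative ℤ))
    (hd : ∀ g h, d (g * h) = d g + MonoidAlgebra.single (f.prod φ g) 1 * d h)
    {k : Pi1 X x₀} (hk : f.prod φ k = 1) (hdk : d k ≠ 0) :
    ∃ z : TwistedH1 φ ((regularRep G).comp f), ∀ s : ℤ[T;T⁻¹], s • z = 0 → s = 0 := by
  obtain ⟨r, hr⟩ := exists_equivariant x₀
  let Θ : SingularChain (UniversalCover x₀) 0 →ₗ[ℤ] MonoidAlgebra ℤ (G × Multiplicative ℤ) :=
    Finsupp.linearCombination ℤ fun τ => d (r (τ default))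
  have hΘ : ∀ p, Θ (Finsupp.single (pointSimplex p) 1) = d (r p) := fun p => by
    simp [Θ, pointSimplex]
  let B : SingularChain (UniversalCover x₀) 1 →ₗ[ℤ]
      ((G → ℤ[T;T⁻¹]) →ₗ[ℤ[T;T⁻¹]] ℤ[T;T⁻¹]) :=
    groupRingPairing.toIntLinearMap.comp (Θ.comp (singularBoundary (UniversalCover x₀) 0))
  have hB : ∀ c, B c = groupRingPairing (Θ (singularBoundary (UniversalCover x₀) 0 c)) :=
    fun c => rfl
  have hBpath : ∀ {p q : UniversalCover x₀} (γ : Path p q),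
      B (Finsupp.single (pathSimplex γ) 1) = groupRingPairing (d (r q) - d (r p)) := by
    intro p q γ
    rw [hB, singularBoundary_pathSimplex, map_sub, hΘ, hΘ]
  -- `Θ` is not equivariant, but its defect `d g` is the same at both end points and cancels in the
  -- difference. So `L` exists although it need not factor through the twisted 0-chains.
  let L : TwistedChain φ ((regularRep G).comp f) 1 →ₗ[ℤ[T;T⁻¹]] ℤ[T;T⁻¹] := chainLift B <| by
    intro g τ m
    obtain ⟨γ, hγ⟩ := exists_pathSimplex_eq τ
    rw [← hγ, chainAction_pathSimplex, hBpath, hBpath, coeffAction_eq_rightTranslate,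
      ← groupRingPairing_single_mul, hr, hr, hd, hd, mul_sub, add_sub_add_left_eq_sub]
  have hL : ∀ y, L (twistedBoundary φ ((regularRep G).comp f) 1 y) = 0 := by
    intro y
    induction y using TwistedChain.induction with
    | zero => simp
    | add y z hy hz => rw [map_add, map_add, hy, hz, add_zero]
    | simplex τ m =>
      rw [twistedBoundary_chainClass, chainLift_chainClass, hB, singularBoundary_singularBoundary]
      simp
  obtain ⟨m, hm⟩ : ∃ m, groupRingPairing (d k) m ≠ 0 := by
    by_contra! h
    refine hdk (groupRingPairing_injective ?_)
    rw [map_zero]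
    exact LinearMap.ext h
  let p : UniversalCover x₀ := ⟨x₀, Path.Homotopic.Quotient.refl x₀⟩
  obtain ⟨γ⟩ : Nonempty (Path p (k • p)) := nonempty_path _ _
  let y := chainClass φ ((regularRep G).comp f) 1 (Finsupp.single (pathSimplex γ) 1) m
  have hy : twistedBoundary φ ((regularRep G).comp f) 0 y = 0 := by
    rw [twistedBoundary_chainClass, singularBoundary_pathSimplex, map_sub, LinearMap.sub_apply,
      ← chainAction_pointSimplex, ← chainClass_coeffAction, coeffAction_eq_rightTranslate, hk,
      rightTranslate_one, sub_self]
  have hLy : L y = groupRingPairing (d k) m := by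
    rw [chainLift_chainClass, hBpath, hr, hd, hk, ← MonoidAlgebra.one_def, one_mul,
      add_sub_cancel_right]
  refine ⟨Submodule.Quotient.mk ⟨y, hy⟩, fun s hs => ?_⟩
  rw [← Submodule.Quotient.mk_smul, Submodule.Quotient.mk_eq_zero] at hs
  obtain ⟨z, hz⟩ := hs
  have h0 : L (s • y) = 0 := by
    rw [← hL z]
    exact congrArg L hz.symm
  rw [map_smul, hLy, smul_eq_mul, mul_eq_zero] at h0
  exact h0.resolve_right hm

end OfDerivation

/-! ### Paths in the covering and twisted one-chains modulo boundaries -/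

section Segment

variable {X : Type u} [TopologicalSpace X] {x₀ : X} {R : Type v} [CommRing R]
  {ι : Type w} [Fintype ι] [DecidableEq ι]
  (φ : Pi1 X x₀ →* Multiplicative ℤ) (ρ : Pi1 X x₀ →* GL ι R)

/-- The twisted `1`-chains modulo boundaries. -/
abbrev TwistedChainModBoundary : Type (max u v w) :=
  TwistedChain φ ρ 1 ⧸ LinearMap.range (twistedBoundary φ ρ 1)

/-- The map `c ↦ (m ↦ m ⊗ c)` for `1`-chains modulo boundaries. -/
def chainModBoundary :
    (SingularChain (UniversalCover x₀) 1 ⧸ LinearMap.range (singularBoundary (UniversalCover x₀) 1))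
      →ₗ[ℤ] ((ι → R[T;T⁻¹]) →ₗ[R[T;T⁻¹]] TwistedChainModBoundary φ ρ) :=
  Submodule.liftQ _
    { toFun := fun c => (LinearMap.range (twistedBoundary φ ρ 1)).mkQ.comp (chainClass φ ρ 1 c)
      map_add' := fun c c' => by rw [map_add, LinearMap.comp_add]
      map_smul' := fun a c => by ext; simp } <| by
    rintro _ ⟨c, rfl⟩
    exact LinearMap.ext fun m => (Submodule.Quotient.mk_eq_zero _).2
      (LinearMap.mem_range.2 ⟨_, twistedBoundary_chainClass c m⟩)

theorem chainModBoundary_mk (c : SingularChain (UniversalCover x₀) 1) (m : ι → R[T;T⁻¹]) :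
    chainModBoundary φ ρ (Submodule.Quotient.mk c) m =
      (LinearMap.range (twistedBoundary φ ρ 1)).mkQ (chainClass φ ρ 1 c m) := rfl

/-- The class of `m ⊗ γ` in the twisted `1`-chains modulo boundaries, for a path `γ` from `p` to `q`
in the universal covering. -/
def segment (p q : UniversalCover x₀) :
    (ι → R[T;T⁻¹]) →ₗ[R[T;T⁻¹]] TwistedChainModBoundary φ ρ :=
  chainModBoundary φ ρ (pathClass (nonempty_path p q).some)

variable [SimplyConnectedSpace (UniversalCover x₀)] {φ ρ}

/-- Simple connectivity makes the class independent of the chosen path. -/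
theorem segment_eq {p q : UniversalCover x₀} (γ : Path p q) :
    segment φ ρ p q = chainModBoundary φ ρ (pathClass γ) := by
  rw [segment, pathClass_eq_of_homotopic (SimplyConnectedSpace.paths_homotopic _ γ)]

theorem mkQ_chainClass (τ : SingularSimplex (UniversalCover x₀) 1) (m : ι → R[T;T⁻¹]) :
    (LinearMap.range (twistedBoundary φ ρ 1)).mkQ (chainClass φ ρ 1 (Finsupp.single τ 1) m) =
      segment φ ρ (simplexStart τ) (simplexEnd τ) m := by
  obtain ⟨γ, hγ⟩ := exists_pathSimplex_eq τ
  rw [segment_eq γ, pathClass, chainModBoundary_mk, hγ]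

theorem segment_add (p q r : UniversalCover x₀) :
    segment φ ρ p q + segment φ ρ q r = segment φ ρ p r := by
  obtain ⟨α⟩ := nonempty_path p q
  obtain ⟨β⟩ := nonempty_path q r
  rw [segment_eq α, segment_eq β, segment_eq (α.trans β), pathClass_trans, map_add]

theorem segment_self (p : UniversalCover x₀) : segment φ ρ p p = 0 := by
  simpa using segment_add (φ := φ) (ρ := ρ) p p p

theorem segment_coeffAction (g : Pi1 X x₀) (p q : UniversalCover x₀) (m : ι → R[T;T⁻¹]) :
    segment φ ρ p q (coeffAction φ ρ g m) = segment φ ρ (g • p) (g • q) m := by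
  obtain ⟨γ⟩ := nonempty_path p q
  rw [segment_eq γ, segment_eq (γ.map (continuous_const_smul g)), pathClass, pathClass,
    chainModBoundary_mk, chainModBoundary_mk, chainClass_coeffAction, chainAction_pathSimplex]

variable (φ ρ) in
/-- The class of `m ⊗ γ` for a path `γ` from the base point `p` to `g • p`. -/
def deckSegment (p : UniversalCover x₀) (g : Pi1 X x₀) :
    (ι → R[T;T⁻¹]) →ₗ[R[T;T⁻¹]] TwistedChainModBoundary φ ρ :=
  segment φ ρ p (g • p)

theorem deckSegment_one (p : UniversalCover x₀) : deckSegment φ ρ p 1 = 0 := by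
  rw [deckSegment, one_smul, segment_self]

/-- Pass from `p` to `(g * h) • p` through `g • p`; the second piece is the `g`-translate of a path
from `p` to `h • p`. -/
theorem deckSegment_mul (p : UniversalCover x₀) (g h : Pi1 X x₀) (m : ι → R[T;T⁻¹]) :
    deckSegment φ ρ p (g * h) m =
      deckSegment φ ρ p g m + deckSegment φ ρ p h (coeffAction φ ρ g m) := by
  rw [deckSegment, deckSegment, deckSegment, segment_coeffAction, ← LinearMap.add_apply,
    segment_add, mul_smul]

end Segment

/-! ### Embedding the homology in the module of loops, and derivations from functionals -/

section Finite

variable {X : Type u} [TopologicalSpace X] {x₀ : X} {G : Type v} [Group G] [Fintype G]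
  [DecidableEq G] (φ : Pi1 X x₀ →* Multiplicative ℤ) (f : Pi1 X x₀ →* G)

/-- The submodule of the twisted `1`-chains modulo boundaries that is generated by the loops. -/
def loopSubmodule (p : UniversalCover x₀) :
    Submodule ℤ[T;T⁻¹] (TwistedChainModBoundary φ ((regularRep G).comp f)) :=
  ⨆ g : Pi1 X x₀, LinearMap.range (deckSegment φ ((regularRep G).comp f) p g)

theorem deckSegment_mem (p : UniversalCover x₀) (g : Pi1 X x₀) (m : G → ℤ[T;T⁻¹]) :
    deckSegment φ ((regularRep G).comp f) p g m ∈ loopSubmodule φ f p :=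
  Submodule.mem_iSup_of_mem g ⟨m, rfl⟩

/-- On cycles `V` agrees with the quotient map, so its kernel there consists precisely of the
boundaries. -/
theorem exists_embedding_of_retraction {p : UniversalCover x₀}
    {V : TwistedChain φ ((regularRep G).comp f) 1 →ₗ[ℤ[T;T⁻¹]] loopSubmodule φ f p}
    (hV : ∀ y, twistedBoundary φ ((regularRep G).comp f) 0 y = 0 →
        (V y : TwistedChainModBoundary φ ((regularRep G).comp f)) = Submodule.Quotient.mk y) :
    ∃ J : TwistedH1 φ ((regularRep G).comp f) →ₗ[ℤ[T;T⁻¹]] loopSubmodule φ f p,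
      Function.Injective J ∧ ∀ y, J (Submodule.Quotient.mk y) = V y := by
  have key : ∀ y : LinearMap.ker (twistedBoundary φ ((regularRep G).comp f) 0),
      V y = 0 ↔ (y : TwistedChain φ ((regularRep G).comp f) 1) ∈
        LinearMap.range (twistedBoundary φ ((regularRep G).comp f) 1) := fun y => by
    rw [← Submodule.coe_eq_zero, hV y y.2, Submodule.Quotient.mk_eq_zero]
  refine ⟨Submodule.liftQ _ (V.comp (Submodule.subtype _)) fun y hy => (key y).2 hy, ?_,
    fun y => rfl⟩
  rw [← LinearMap.ker_eq_bot, LinearMap.ker_eq_bot']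
  intro z hz
  obtain ⟨y, rfl⟩ := Submodule.Quotient.mk_surjective _ z
  exact (Submodule.Quotient.mk_eq_zero _).2 ((key y).1 hz)

variable [SimplyConnectedSpace (UniversalCover x₀)]

/-- By the cocycle rule, the segments of finitely many group generators suffice, and each
contributes an image of the finite free module `G → ℤ[T;T⁻¹]`. -/
theorem loopSubmodule_fg [Group.FG (Pi1 X x₀)] (p : UniversalCover x₀) :
    (loopSubmodule φ f p).FG := by
  obtain ⟨S, hS⟩ := Group.fg_def.1 (inferInstance : Group.FG (Pi1 X x₀))
  have : loopSubmodule φ f p =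
      ⨆ g ∈ S, LinearMap.range (deckSegment φ ((regularRep G).comp f) p g) := by
    refine le_antisymm (iSup_le fun g => ?_) (iSup₂_le fun g _ => le_iSup_of_le g le_rfl)
    rintro _ ⟨m, rfl⟩
    have hg : g ∈ Subgroup.closure (S : Set (Pi1 X x₀)) := hS ▸ Subgroup.mem_top g
    induction hg using Subgroup.closure_induction generalizing m with
    | mem g hg => exact Submodule.mem_iSup_of_mem g (Submodule.mem_iSup_of_mem hg ⟨m, rfl⟩)
    | one => rw [deckSegment_one]; exact zero_mem _
    | mul g h _ _ hg hh => rw [deckSegment_mul]; exact add_mem (hg _) (hh _)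
    | inv g _ hg =>
      -- The coefficient is translated by `g⁻¹` in advance, so that the action of `g` in the cocycle
      -- rule returns `m`.
      have h1 := deckSegment_mul (φ := φ) (ρ := (regularRep G).comp f) p g g⁻¹
        (rightTranslate (f.prod φ g⁻¹) m)
      rw [mul_inv_cancel, deckSegment_one, LinearMap.zero_apply, coeffAction_eq_rightTranslate,
        ← rightTranslate_mul, ← map_mul, inv_mul_cancel, map_one, rightTranslate_one] at h1
      rw [eq_neg_of_add_eq_zero_right h1.symm]
      exact neg_mem (hg _)
  rw [this]
  exact Submodule.fg_biSup S _ fun g _ => Module.Finite.iff_fg.1 (Module.Finite.range _)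

/-- The retraction of the twisted `1`-chains modulo boundaries to `loopSubmodule`, for a function
`r` that is equivariant. -/
theorem exists_retraction (p : UniversalCover x₀) (r : UniversalCover x₀ → Pi1 X x₀)
    (hr : ∀ g q, r (g • q) = g * r q) :
    ∃ V : TwistedChain φ ((regularRep G).comp f) 1 →ₗ[ℤ[T;T⁻¹]] loopSubmodule φ f p,
      (∀ y, twistedBoundary φ ((regularRep G).comp f) 0 y = 0 →
        (V y : TwistedChainModBoundary φ ((regularRep G).comp f)) = Submodule.Quotient.mk y) ∧
      ∀ τ m, (V (chainClass φ ((regularRep G).comp f) 1 (Finsupp.single τ 1) m) :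
          TwistedChainModBoundary φ ((regularRep G).comp f)) =
        deckSegment φ ((regularRep G).comp f) p (r (simplexEnd τ)) m -
          deckSegment φ ((regularRep G).comp f) p (r (simplexStart τ)) m := by
  -- `U` joins each vertex `q` to the orbit point `r q • p`. Subtracting `U ∘ ∂` moves the ends of
  -- every path into the orbit of `p` and leaves cycles unchanged modulo boundaries.
  let U : TwistedChain φ ((regularRep G).comp f) 0 →ₗ[ℤ[T;T⁻¹]]
      TwistedChainModBoundary φ ((regularRep G).comp f) :=
    chainLift (Finsupp.linearCombination ℤ fun τ =>
      segment φ ((regularRep G).comp f) (r (τ default) • p) (τ default)) <| by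
      intro g τ m
      rw [chainAction_single, Finsupp.linearCombination_single, Finsupp.linearCombination_single,
        one_smul, one_smul, segment_coeffAction]
      change _ = segment φ ((regularRep G).comp f) (r (g • τ default) • p) (g • τ default) m
      rw [hr, mul_smul]
  have hU : ∀ q m, U (chainClass φ ((regularRep G).comp f) 0 (Finsupp.single (pointSimplex q) 1) m)
      = segment φ ((regularRep G).comp f) (r q • p) q m := by
    intro q m
    rw [chainLift_chainClass, Finsupp.linearCombination_single, one_smul]
    rfl
  let V := (LinearMap.range (twistedBoundary φ ((regularRep G).comp f) 1)).mkQ -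
    U.comp (twistedBoundary φ ((regularRep G).comp f) 0)
  have hV : ∀ τ m, V (chainClass φ ((regularRep G).comp f) 1 (Finsupp.single τ 1) m) =
      deckSegment φ ((regularRep G).comp f) p (r (simplexEnd τ)) m -
          deckSegment φ ((regularRep G).comp f) p (r (simplexStart τ)) m := by
    intro τ m
    simp only [V, LinearMap.sub_apply, LinearMap.comp_apply]
    rw [mkQ_chainClass, twistedBoundary_chainClass, singularBoundary_single_one, map_sub,
      LinearMap.sub_apply, map_sub, hU, hU, deckSegment, deckSegment,
      ← segment_add p (r (simplexStart τ) • p) (r (simplexEnd τ) • p), LinearMap.add_apply,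
      add_sub_cancel_left, sub_sub_eq_add_sub, sub_eq_iff_eq_add,
      add_comm (segment φ ((regularRep G).comp f) (simplexStart τ) (simplexEnd τ) m),
      ← LinearMap.add_apply, ← LinearMap.add_apply, segment_add, segment_add]
  have hVmem : ∀ y, V y ∈ loopSubmodule φ f p := by
    intro y
    induction y using TwistedChain.induction with
    | zero => rw [map_zero]; exact zero_mem _
    | add y z hy hz => rw [map_add]; exact add_mem hy hz
    | simplex τ m =>
      rw [hV]
      exact sub_mem (deckSegment_mem φ f p _ m) (deckSegment_mem φ f p _ m)
  refine ⟨V.codRestrict _ hVmem, fun y hy => ?_, hV⟩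
  change V y = _
  simp [V, hy]

theorem finite_twistedH1 [Group.FG (Pi1 X x₀)] :
    Module.Finite ℤ[T;T⁻¹] (TwistedH1 φ ((regularRep G).comp f)) := by
  obtain ⟨r, hr⟩ := exists_equivariant x₀
  let p : UniversalCover x₀ := ⟨x₀, Path.Homotopic.Quotient.refl x₀⟩
  obtain ⟨V, hV, -⟩ := exists_retraction φ f p r hr
  obtain ⟨J, hJ, -⟩ := exists_embedding_of_retraction φ f hV
  have := Module.Finite.iff_fg.2 (loopSubmodule_fg φ f p)
  exact Module.Finite.of_injective J hJ

/-- The derivation consists of the values on loops of a functional that is nonzero at the class. Its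
vanishing on the kernel would force this functional to vanish on every cycle. -/
theorem exists_derivation_of_not_torsion [Group.FG (Pi1 X x₀)]
    {z : TwistedH1 φ ((regularRep G).comp f)} (hz : ∀ s : ℤ[T;T⁻¹], s • z = 0 → s = 0) :
    ∃ d : Pi1 X x₀ → MonoidAlgebra ℤ (G × Multiplicative ℤ),
      (∀ g h, d (g * h) = d g + MonoidAlgebra.single (f.prod φ g) 1 * d h) ∧
        ∃ k, f.prod φ k = 1 ∧ d k ≠ 0 := by
  obtain ⟨r, hr⟩ := exists_equivariant x₀
  let p : UniversalCover x₀ := ⟨x₀, Path.Homotopic.Quotient.refl x₀⟩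
  obtain ⟨V, hV, hVs⟩ := exists_retraction φ f p r hr
  obtain ⟨J, hJ, hJV⟩ := exists_embedding_of_retraction φ f hV
  have := Module.Finite.iff_fg.2 (loopSubmodule_fg φ f p)
  obtain ⟨l, hl⟩ := exists_functional_ne_zero (z := J z) fun s hs =>
    hz s (hJ (by rw [map_smul, hs, map_zero]))
  choose d hd using fun g : Pi1 X x₀ => groupRingPairing_surjective (G := G)
    (l.comp ((deckSegment φ ((regularRep G).comp f) p g).codRestrict _ (deckSegment_mem φ f p g)))
  replace hd : ∀ g m, groupRingPairing (d g) m = l ⟨_, deckSegment_mem φ f p g m⟩ := fun g m => by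
    rw [hd]
    rfl
  have hder : ∀ g h, d (g * h) = d g + MonoidAlgebra.single (f.prod φ g) 1 * d h := by
    intro g h
    refine groupRingPairing_injective (LinearMap.ext fun m => ?_)
    rw [map_add, LinearMap.add_apply, groupRingPairing_single_mul, hd, hd, hd, ← map_add]
    congr 1
    ext1
    rw [← coeffAction_eq_rightTranslate]
    exact deckSegment_mul p g h m
  refine ⟨d, hder, ?_⟩
  by_contra! hker
  obtain ⟨D, hD⟩ := exists_primitive_of_derivation (f.prod φ) d hder hker
  let ξ : TwistedChain φ ((regularRep G).comp f) 0 →ₗ[ℤ[T;T⁻¹]] (G → ℤ[T;T⁻¹]) :=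
    chainLift (Finsupp.linearCombination ℤ fun τ => rightTranslate (f.prod φ (r (τ default)))) <| by
      intro g τ m
      rw [chainAction_single, Finsupp.linearCombination_single, Finsupp.linearCombination_single,
        one_smul, one_smul, coeffAction_eq_rightTranslate, ← rightTranslate_mul, ← map_mul, ← hr]
      rfl
  have hξ : ∀ q m, ξ (chainClass φ ((regularRep G).comp f) 0 (Finsupp.single (pointSimplex q) 1) m)
      = rightTranslate (f.prod φ (r q)) m := by
    intro q m
    rw [chainLift_chainClass, Finsupp.linearCombination_single, one_smul]
    rfl
  -- On `m ⊗ τ` both sides are the difference of the pairings of `m` with `d (r q)` at the two end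
  -- points `q`; the terms `D m` cancel.
  have key : ∀ y, l (V y) = D (ξ (twistedBoundary φ ((regularRep G).comp f) 0 y)) := by
    intro y
    induction y using TwistedChain.induction with
    | zero => simp
    | add y z hy hz => simp only [map_add, hy, hz]
    | simplex τ m =>
      have h1 : V (chainClass φ ((regularRep G).comp f) 1 (Finsupp.single τ 1) m) =
          ⟨_, deckSegment_mem φ f p (r (simplexEnd τ)) m⟩ -
            ⟨_, deckSegment_mem φ f p (r (simplexStart τ)) m⟩ := Subtype.ext (hVs τ m)
      rw [h1, twistedBoundary_chainClass, singularBoundary_single_one, map_sub, map_sub,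
        LinearMap.sub_apply, map_sub, hξ, hξ, map_sub, hD, hD, ← hd, ← hd, add_sub_add_left_eq_sub]
  obtain ⟨y, rfl⟩ := Submodule.Quotient.mk_surjective _ z
  refine hl ?_
  rw [hJV, key, show twistedBoundary φ ((regularRep G).comp f) 0 y = 0 from y.2, map_zero, map_zero]

end Finite

/-! ### Simple connectivity of the covering and the main theorem -/

theorem simplyConnectedSpace_universalCover {X : Type u} [TopologicalSpace X]
    [PathConnectedSpace X] [LocallyPathConnectedSpace X] (x₀ : X)
    (hX : ∀ x : X, ∃ U, IsOpen U ∧ x ∈ U ∧ IsInessential U) :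
    SimplyConnectedSpace (UniversalCover x₀) :=
  simply_connected_iff_paths_homotopic'.2
    ⟨inferInstance, fun {_ _} α β => homotopic_of_cover hX α β⟩

end TwistedAlexander

end

theorem mainTheorem4 {X : Type u} [TopologicalSpace X] [T2Space X]
    [Topology.CWComplex (Set.univ : Set X)] [Topology.CWComplex.Finite (Set.univ : Set X)]
    [ConnectedSpace X] (x₀ : X) {G : Type v} [Group G] [Fintype G] [DecidableEq G]
    (φ : TwistedAlexander.Pi1 X x₀ →* Multiplicative ℤ) (f : TwistedAlexander.Pi1 X x₀ →* G) :
    (∃ Δ : ℤ[T;T⁻¹], TwistedAlexander.IsTwistedAlexanderPolynomial φ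
      ((TwistedAlexander.regularRep G).comp f) Δ) ∧
    ∀ Δ : ℤ[T;T⁻¹], TwistedAlexander.IsTwistedAlexanderPolynomial φ
        ((TwistedAlexander.regularRep G).comp f) Δ →
      (Δ = 0 ↔ ∃ l : TwistedAlexander.Pi1 X x₀ →*
          TwistedAlexander.GroupRingSemidirect (G × Multiplicative ℤ),
        TwistedAlexander.IsNontrivialLift (f.prod φ) l) := by
  have := TwistedAlexander.compactSpace_of_finite X
  have := TwistedAlexander.locallyPathConnectedSpace_of_finite X
  have := (pathConnectedSpace_iff_connectedSpace (X := X)).2 inferInstance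
  have hX := fun x : X => TwistedAlexander.exists_isInessential_nhd x
  have := TwistedAlexander.simplyConnectedSpace_universalCover x₀ hX
  have := TwistedAlexander.fg_pi1 hX x₀
  have := TwistedAlexander.finite_twistedH1 φ f
  refine ⟨TwistedAlexander.exists_isOrder _ _, fun Δ hΔ => ?_⟩
  rw [TwistedAlexander.isOrder_eq_zero_iff hΔ, TwistedAlexander.exists_isNontrivialLift_iff]
  constructor
  · rintro ⟨z, hz⟩
    exact TwistedAlexander.exists_derivation_of_not_torsion φ f hz
  · rintro ⟨d, hd, k, hk, hdk⟩
    exact TwistedAlexander.exists_not_torsion_of_derivation d hd hk hdk
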